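/- Let $E=(E^0,E^1,r,s)$ be an arbitrary directed graph (loops, multiple edges, sinks, infinite emitters and any cardinality are allowed), and let $R$ be a commutative ring with unit. The Leavitt path algebra $L_R(E)$ is the universal associative, not necessarily unital, $R$-algebra generated by pairwise orthogonal idempotents $v$ ($v\in E^0$) and elements $e,e^*$ ($e\in E^1$) subject to $s(e)e=e=e\,r(e)$; $r(e)e^*=e^*=e^*s(e)$; $e^*e=r(e)$ and $e^*f=0$ for $e\neq f$; and $v=\sum_{s(e)=v}ee^*$ whenever $s^{-1}(v)$ is finite and non-empty. It carries the $R$-linear involution with $v^*=v$ and $e\leftrightarrow e^*$. A finite path $\mu=e_1\cdots e_n$ (vertices are the paths of length $0$) is viewed as an element of $L_R(E)$. The commutative core $M_R(E)$ is the $R$-subalgebra of $L_R(E)$ generated by all elements $x=\alpha\beta^*$, with $\alpha,\beta$ finite paths and $r(\alpha)=r(\beta)$, that are normal, i.e. $xx^*=x^*x$. An infinite path $\tau=e_1e_2\cdots$ is periodic if there are $j,k\ge 1$ with $e_{n+k}=e_n$ for all $n\ge j$; taking $j,k$ with $j+k$ minimal, its seed is $(\alpha,\lambda)$ with $\alpha=e_1\cdots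 e_{j-1}$ (the vertex $s(e_1)$ if $j=1$) and $\lambda=e_j\cdots e_{j+k-1}$. If $\lambda$ has no exit (no edge $e$ satisfies $s(e)=s(e_i)$ and $e\ne e_i$ for an edge $e_i$ of $\lambda$), then $\alpha$ is called a distinguished path. In this case $\lambda=\lambda_\alpha$ is determined by $\alpha$, and we put $\omega_\alpha=\alpha\lambda_\alpha\alpha^*$. For an element $y$ of an $R$-algebra with involution, $\langle y\rangle$ denotes the $*$-$R$-subalgebra (not necessarily unital) generated by $y$. The algebra $R[x,x^{-1}]$ carries the $R$-linear involution with $x^*=x^{-1}$. Theorem. Let $\Phi:L_R(E)\to\mathcal A$ be a ring homomorphism into a ring $\mathcal A$. The following are equivalent: (i) $\Phi$ is injective; (ii) the restriction of $\Phi$ to $M_R(E)$ is injective; (iii) (a) $\Phi(rv)\ne 0$ for all $v\in E^0$ and all $r\in R\setminus\{0\}$; and (b) for every distinguished path $\alpha$, the $*$-$R$-algebra $\langle\Phi(\omega_\alpha)\rangle$ is $*$-isomorphic, as an $R$-algebra, to $R[x,x^{-1}]$. In (b), $\langle\Phi(\omega_\alpha)\rangle$ means the following. If $\mathcal A$ is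 an $R$-algebra with $R$-linear involution and $\Phi$ is a homomorphism of $R$-algebras that preserves the involution, then it is the $*$-$R$-subalgebra of $\mathcal A$ generated by $\Phi(\omega_\alpha)$. For an arbitrary ring $\mathcal A$ and an arbitrary ring homomorphism $\Phi$, it is the subring $\Phi(\langle\omega_\alpha\rangle)$ of $\mathcal A$ with the operations $r\cdot\Phi(y)=\Phi(ry)$ and $\Phi(y)^*=\Phi(y^*)$ for $y\in\langle\omega_\alpha\rangle$ (condition (b) includes that these are well defined). The equivalence holds in both settings. -/

import Mathlib

open scoped LaurentPolynomial

/-- A directed graph with vertex set `V`, edge set `E`, and source and range maps. Loops and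
multiple edges are allowed, and there is no restriction on cardinality. -/
structure DirectedMultigraph (V : Type*) (E : Type*) where
  source : E → V
  range : E → V

namespace DirectedMultigraph

variable {V E : Type*} (G : DirectedMultigraph V E)

/-- `G.IsPathFromTo v l w`: the list of edges `l` is a path from `v` to `w`; the empty list is
the path of length zero at `v = w`. -/
def IsPathFromTo : V → List E → V → Prop
  | v, [], w => v = w
  | v, e :: l, w => G.source e = v ∧ IsPathFromTo (G.range e) l w

/-- Finite paths; a vertex is a path of length zero. -/
structure FinPath where
  source : V
  edges : List E
  range : V
  isPath : G.IsPathFromTo source edges range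

/-- An infinite sequence of edges `τ 0, τ 1, …` is an infinite path. -/
def IsInfinitePath (τ : ℕ → E) : Prop :=
  ∀ n, G.range (τ n) = G.source (τ (n + 1))

/-- From index `j` on, the sequence `τ` repeats with period `k ≥ 1`. -/
def RepeatsFrom (τ : ℕ → E) (j k : ℕ) : Prop :=
  1 ≤ k ∧ ∀ n, j ≤ n → τ (n + k) = τ n

variable {G} in
/-- `(α, c)` is the seed of the periodic infinite path `τ`: for the pair `(j, k)` with `j + k`
smallest possible such that `τ` repeats with period `k` from index `j` on, `α` consists of the
edges before index `j`, and `c` of the `k` edges that follow. Indices start at `0`. -/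
def IsSeed (τ : ℕ → E) (α c : G.FinPath) : Prop :=
  ∃ j k : ℕ, RepeatsFrom τ j k ∧
    (∀ j' k' : ℕ, RepeatsFrom τ j' k' → j + k ≤ j' + k') ∧
    α.source = G.source (τ 0) ∧ α.edges = (List.range j).map τ ∧
    c.source = G.source (τ j) ∧ c.edges = (List.range k).map (fun i => τ (j + i))

variable {G} in
/-- A path has no exit: the only edge starting at the source of one of its edges is that edge. -/
def FinPath.HasNoExit (c : G.FinPath) : Prop :=
  ∀ f ∈ c.edges, ∀ e : E, G.source e = G.source f → e = f

variable {G} in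
/-- `α` is a distinguished path with associated cycle without exits `c`: the pair `(α, c)` is the
seed of a periodic infinite path whose period `c` has no exits. -/
def IsDistinguished (α c : G.FinPath) : Prop :=
  ∃ τ : ℕ → E, G.IsInfinitePath τ ∧ IsSeed τ α c ∧ c.HasNoExit

end DirectedMultigraph

namespace Leavitt

open DirectedMultigraph

/-- Generating symbols: vertices, edges and ghost edges. -/
inductive Gen (V : Type*) (E : Type*) where
  | vert : V → Gen V E
  | edge : E → Gen V E
  | ghost : E → Gen V E

/-- The involution on symbols: vertices are fixed, an edge and its ghost edge are exchanged. -/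
def Gen.dual {V E : Type*} : Gen V E → Gen V E
  | .vert v => .vert v
  | .edge e => .ghost e
  | .ghost e => .edge e

section Algebra

variable {V E : Type*} (G : DirectedMultigraph V E) (R : Type*) [CommRing R]

/-- A symbol as an element of the free algebra. -/
def sym {V E : Type*} (R : Type*) [CommRing R] (g : Gen V E) : FreeAlgebra R (Gen V E) :=
  FreeAlgebra.ι R g

/-- The defining relations of the Leavitt path algebra. -/
inductive Rel : FreeAlgebra R (Gen V E) → FreeAlgebra R (Gen V E) → Prop
  | vert_idem (v : V) : Rel (sym R (.vert v) * sym R (.vert v)) (sym R (.vert v))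
  | vert_orth (v w : V) (h : v ≠ w) : Rel (sym R (.vert v) * sym R (.vert w)) 0
  | source_edge (e : E) :
      Rel (sym R (.vert (G.source e)) * sym R (.edge e)) (sym R (.edge e))
  | edge_range (e : E) :
      Rel (sym R (.edge e) * sym R (.vert (G.range e))) (sym R (.edge e))
  | range_ghost (e : E) :
      Rel (sym R (.vert (G.range e)) * sym R (.ghost e)) (sym R (.ghost e))
  | ghost_source (e : E) :
      Rel (sym R (.ghost e) * sym R (.vert (G.source e))) (sym R (.ghost e))
  | ck1_same (e : E) :
      Rel (sym R (.ghost e) * sym R (.edge e)) (sym R (.vert (G.range e)))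
  | ck1_ne (e f : E) (h : e ≠ f) : Rel (sym R (.ghost e) * sym R (.edge f)) 0
  | ck2 (v : V) (hfin : {e : E | G.source e = v}.Finite)
      (hne : {e : E | G.source e = v}.Nonempty) :
      Rel (∑ e ∈ hfin.toFinset, sym R (.edge e) * sym R (.ghost e)) (sym R (.vert v))

/-- The unital algebra with the above generators and relations. Since all relations hold between
elements without constant term, this is the Leavitt path algebra with a unit adjoined. -/
abbrev Unital : Type _ := RingQuot (Rel G R)

/-- The class of a symbol. -/
def gen (g : Gen V E) : Unital G R := RingQuot.mkAlgHom R (Rel G R) (sym R g)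

/-- The Leavitt path algebra as the (non-unital) subalgebra generated by the symbols. It is the
universal `R`-algebra, not necessarily unital, with the above generators and relations. -/
abbrev subalgebra : NonUnitalSubalgebra R (Unital G R) :=
  NonUnitalAlgebra.adjoin R (Set.range (gen G R))

/-- The Leavitt path algebra `L_R(G)`. -/
abbrev LPA : Type _ := ↥(subalgebra G R)

open MulOpposite in
/-- The assignment `x ↦ op (x^*)` on the free algebra. -/
def freeStar : FreeAlgebra R (Gen V E) →ₐ[R] (Unital G R)ᵐᵒᵖ :=
  FreeAlgebra.lift R (fun g => op (gen G R g.dual))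

theorem freeStar_sym (g : Gen V E) :
    freeStar G R (sym R g) = MulOpposite.op (gen G R g.dual) := by
  simp [freeStar, sym]

variable {G R} in
theorem rel_eq {x y : FreeAlgebra R (Gen V E)} (h : Rel G R x y) :
    RingQuot.mkAlgHom R (Rel G R) x = RingQuot.mkAlgHom R (Rel G R) y :=
  RingQuot.mkAlgHom_rel R h

theorem freeStar_rel ⦃x y : FreeAlgebra R (Gen V E)⦄ (h : Rel G R x y) :
    freeStar G R x = freeStar G R y := by
  apply MulOpposite.unop_injective
  cases h with
  | vert_idem v =>
    simpa [freeStar_sym, Gen.dual, gen] using rel_eq (Rel.vert_idem (G := G) (R := R) v)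
  | vert_orth v w h =>
    simpa [freeStar_sym, Gen.dual, gen] using
      rel_eq (Rel.vert_orth (G := G) (R := R) w v (Ne.symm h))
  | source_edge e =>
    simpa [freeStar_sym, Gen.dual, gen] using rel_eq (Rel.ghost_source (G := G) (R := R) e)
  | edge_range e =>
    simpa [freeStar_sym, Gen.dual, gen] using rel_eq (Rel.range_ghost (G := G) (R := R) e)
  | range_ghost e =>
    simpa [freeStar_sym, Gen.dual, gen] using rel_eq (Rel.edge_range (G := G) (R := R) e)
  | ghost_source e =>
    simpa [freeStar_sym, Gen.dual, gen] using rel_eq (Rel.source_edge (G := G) (R := R) e)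
  | ck1_same e =>
    simpa [freeStar_sym, Gen.dual, gen] using rel_eq (Rel.ck1_same (G := G) (R := R) e)
  | ck1_ne e f h =>
    simpa [freeStar_sym, Gen.dual, gen] using
      rel_eq (Rel.ck1_ne (G := G) (R := R) f e (Ne.symm h))
  | ck2 v hfin hne =>
    simpa [freeStar_sym, Gen.dual, gen] using rel_eq (Rel.ck2 (R := R) v hfin hne)

/-- The map `x ↦ op (x^*)` as an algebra homomorphism. -/
def starHom : Unital G R →ₐ[R] (Unital G R)ᵐᵒᵖ :=
  RingQuot.liftAlgHom R ⟨freeStar G R, freeStar_rel G R⟩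

theorem starHom_gen (g : Gen V E) :
    starHom G R (gen G R g) = MulOpposite.op (gen G R g.dual) := by
  rw [gen, starHom, RingQuot.liftAlgHom_mkAlgHom_apply, freeStar_sym]

theorem starHom_starHom (x : Unital G R) :
    (starHom G R (starHom G R x).unop).unop = x := by
  obtain ⟨x, rfl⟩ := RingQuot.mkAlgHom_surjective R (Rel G R) x
  induction x using FreeAlgebra.induction with
  | grade0 r => simp
  | grade1 g =>
    change (starHom G R (starHom G R (gen G R g)).unop).unop = gen G R g
    cases g <;> simp [starHom_gen, Gen.dual]
  | mul a b ha hb => simp [ha, hb]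
  | add a b ha hb => simp [ha, hb]

theorem starHom_mem {x : Unital G R} (hx : x ∈ subalgebra G R) :
    (starHom G R x).unop ∈ subalgebra G R := by
  induction hx using NonUnitalAlgebra.adjoin_induction with
  | mem x hx =>
    obtain ⟨g, rfl⟩ := hx
    rw [starHom_gen]
    exact NonUnitalAlgebra.subset_adjoin R ⟨_, rfl⟩
  | add x y _ _ hx hy => simpa using add_mem hx hy
  | zero => simp
  | mul x y _ _ hx hy => simpa using mul_mem hy hx
  | smul r x _ hx => simpa using SMulMemClass.smul_mem r hx

/-- The `R`-linear involution of `L_R(G)`, which fixes the vertices and exchanges `e` with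
`e^*`. -/
instance : StarRing (LPA G R) where
  star x := ⟨(starHom G R x.1).unop, starHom_mem G R x.2⟩
  star_involutive x := Subtype.ext (starHom_starHom G R x.1)
  star_mul x y := Subtype.ext (by simp)
  star_add x y := Subtype.ext (by simp)

theorem star_smul_LPA (r : R) (x : LPA G R) : star (r • x) = r • star x :=
  Subtype.ext (by change (starHom G R (r • x.1)).unop = r • (starHom G R x.1).unop; simp)

/-- The generator `v` of `L_R(G)`. -/
def vertex (v : V) : LPA G R :=
  ⟨gen G R (.vert v), NonUnitalAlgebra.subset_adjoin R ⟨_, rfl⟩⟩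

/-- The generator `e` of `L_R(G)`. -/
def edge (e : E) : LPA G R :=
  ⟨gen G R (.edge e), NonUnitalAlgebra.subset_adjoin R ⟨_, rfl⟩⟩

/-- The generator `e^*` of `L_R(G)`. -/
def ghost (e : E) : LPA G R :=
  ⟨gen G R (.ghost e), NonUnitalAlgebra.subset_adjoin R ⟨_, rfl⟩⟩

theorem star_vertex (v : V) : star (vertex G R v) = vertex G R v :=
  Subtype.ext (by
    change (starHom G R (gen G R (.vert v))).unop = _
    rw [starHom_gen]; rfl)

theorem star_edge (e : E) : star (edge G R e) = ghost G R e :=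
  Subtype.ext (by
    change (starHom G R (gen G R (.edge e))).unop = _
    rw [starHom_gen]; rfl)

/-- The element `v e₁ ⋯ eₙ`. -/
def word : V → List E → LPA G R
  | v, [] => vertex G R v
  | _, e :: l => edge G R e * word (G.range e) l

variable {G} in
/-- A path `e₁ ⋯ eₙ` as an element of `L_R(G)`; a path of length zero is a vertex. -/
def ofPath (μ : G.FinPath) : LPA G R := word G R μ.source μ.edges

/-- The set of those generators `α β^*`, with `α, β` paths and `r(α) = r(β)`, which are normal
elements: `x x^* = x^* x`. -/
def normalGenerators : Set (LPA G R) :=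
  {x | (∃ α β : G.FinPath, α.range = β.range ∧ x = ofPath R α * star (ofPath R β)) ∧
    x * star x = star x * x}

/-- The commutative core `M_R(G)`: the `R`-subalgebra generated by the normal generators. -/
def commutativeCore : NonUnitalSubalgebra R (LPA G R) :=
  NonUnitalAlgebra.adjoin R (normalGenerators G R)

variable {G} in
/-- The element `ω_α = α c α^*` for a distinguished path `α` with cycle `c`. -/
def omega (α c : G.FinPath) : LPA G R := ofPath R α * ofPath R c * star (ofPath R α)

end Algebra

section Targets

variable (R : Type*) [CommRing R]

/-- The `*`-`R`-subalgebra (not necessarily unital) generated by an element `a` of an `R`-algebra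
with `R`-linear involution. -/
def starGenerated {A : Type*} [NonUnitalRing A] [StarRing A] [Module R A] [IsScalarTower R A A]
    [SMulCommClass R A A] (a : A) : NonUnitalSubalgebra R A :=
  NonUnitalAlgebra.adjoin R {a, star a}

/-- A `*`-closed `R`-subalgebra `B` is `*`-isomorphic to `R[x, x⁻¹]`, where the involution on
`R[x, x⁻¹]` is the `R`-linear one with `x^* = x⁻¹`. -/
def StarIsoLaurent {A : Type*} [NonUnitalRing A] [StarRing A] [Module R A]
    (B : NonUnitalSubalgebra R A) : Prop :=
  ∃ g : B →ₙₐ[R] R[T;T⁻¹], Function.Bijective g ∧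
    ∀ a b : B, (b : A) = star (a : A) → g b = LaurentPolynomial.invert (g a)

/-- For a ring homomorphism `Φ : L → A` from an `R`-algebra with involution to a ring, and a
subalgebra `S` of `L` closed under the involution, the ring `Φ(S)`, with the operations
`r • Φ(y) = Φ(r • y)` and `Φ(y)^* = Φ(y^*)` transported from `S`, is `*`-isomorphic to
`R[x, x⁻¹]` as an `R`-algebra. -/
def ImageStarIsoLaurent {L A : Type*} [NonUnitalRing L] [StarRing L] [Module R L]
    [IsScalarTower R L L] [SMulCommClass R L L] [NonUnitalRing A]
    (Φ : L →ₙ+* A) (S : NonUnitalSubalgebra R L) : Prop :=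
  ∃ g : (S.toNonUnitalSubring.map Φ) ≃+* R[T;T⁻¹],
    ∀ y ∈ S, ∀ a : S.toNonUnitalSubring.map Φ, (a : A) = Φ y →
      (∀ (r : R) (b : S.toNonUnitalSubring.map Φ), (b : A) = Φ (r • y) → g b = r • g a) ∧
      (∀ b : S.toNonUnitalSubring.map Φ, (b : A) = Φ (star y) →
        g b = LaurentPolynomial.invert (g a))

end Targets

end Leavitt

/-! The kernel of `Φ` is an ideal, and every nonzero ideal contains an element of a very special
form. Take `x ≠ 0` in it. Some `x v` is nonzero and is a combination of elements `α β^*`;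
multiplying on the right by edges strips ghost edges until a nonzero combination of real paths
ending at one vertex remains (`exists_realPoly_mem`). Multiplying on the left by `μ^*`, with `μ` a
shortest path that occurs, gives `r v + ∑ rᵢ βᵢ` with `r ≠ 0` and closed paths `βᵢ` of positive
length (`exists_star_word_mul_eq`). Conjugation `y ↦ e^* y e` rotates the `βᵢ` that begin with `e`
and kills the others, so when the number of closed paths is minimal none of them has an exit
(`exists_mem_noExit`).

If no `βᵢ` is left, then `r v` is in the kernel, against (a). Otherwise `v` lies on a cycle `c`
without exits, is itself a distinguished path, and all `βᵢ` are powers of `c`; so the element is a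
nonzero member of `⟨ω_v⟩` killed by `Φ`. It remains to see that (b) means injectivity of `Φ` on each
`⟨ω_α⟩`. This algebra is a copy of `R[x, x⁻¹]`, since distinct powers of `ω_α` have distinct
degrees. An abstract isomorphism of its image with `R[x, x⁻¹]` yields a surjective `R`-linear ring
endomorphism of `R[x, x⁻¹]`, and such a map is injective because `R[x, x⁻¹]` is Hopfian
(`laurent_injective_of_surjective`).

For the passage from (ii) to (iii), vertices, `ω_α` and `ω_α^*` are normal generators, so `r v` and
`⟨ω_α⟩` lie in the commutative core. Two facts about `L_R(E)` are used throughout: `r v ≠ 0` for `r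
≠ 0`, proved by a representation on functions, and the `ℤ`-grading by length. -/

namespace Leavitt

open DirectedMultigraph

/-! ### The defining relations inside `L_R(E)`. -/

section Relations

variable {V E : Type*} (G : DirectedMultigraph V E) (R : Type*) [CommRing R]

theorem mkAlgHom_sym (g : Gen V E) :
    RingQuot.mkAlgHom R (Rel G R) (sym R g) = gen G R g := rfl

theorem vertex_mul_self (v : V) : vertex G R v * vertex G R v = vertex G R v :=
  Subtype.ext (by
    simpa [mkAlgHom_sym, vertex, edge, ghost] using rel_eq (Rel.vert_idem (G := G) (R := R) v))

theorem vertex_mul_of_ne {v w : V} (h : v ≠ w) : vertex G R v * vertex G R w = 0 :=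
  Subtype.ext (by
    simpa [mkAlgHom_sym, vertex, edge, ghost] using rel_eq (Rel.vert_orth (G := G) (R := R) v w h))

theorem source_mul_edge (e : E) : vertex G R (G.source e) * edge G R e = edge G R e :=
  Subtype.ext (by
    simpa [mkAlgHom_sym, vertex, edge, ghost] using rel_eq (Rel.source_edge (G := G) (R := R) e))

theorem edge_mul_range (e : E) : edge G R e * vertex G R (G.range e) = edge G R e :=
  Subtype.ext (by
    simpa [mkAlgHom_sym, vertex, edge, ghost] using rel_eq (Rel.edge_range (G := G) (R := R) e))

theorem range_mul_ghost (e : E) : vertex G R (G.range e) * ghost G R e = ghost G R e :=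
  Subtype.ext (by
    simpa [mkAlgHom_sym, vertex, edge, ghost] using rel_eq (Rel.range_ghost (G := G) (R := R) e))

theorem ghost_mul_source (e : E) : ghost G R e * vertex G R (G.source e) = ghost G R e :=
  Subtype.ext (by
    simpa [mkAlgHom_sym, vertex, edge, ghost] using rel_eq (Rel.ghost_source (G := G) (R := R) e))

theorem ghost_mul_edge_self (e : E) : ghost G R e * edge G R e = vertex G R (G.range e) :=
  Subtype.ext (by
    simpa [mkAlgHom_sym, vertex, edge, ghost] using rel_eq (Rel.ck1_same (G := G) (R := R) e))

theorem ghost_mul_edge_of_ne {e f : E} (h : e ≠ f) : ghost G R e * edge G R f = 0 :=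
  Subtype.ext (by
    simpa [mkAlgHom_sym, vertex, edge, ghost] using rel_eq (Rel.ck1_ne (G := G) (R := R) e f h))

theorem sum_edge_mul_ghost (v : V) (hfin : {e : E | G.source e = v}.Finite)
    (hne : {e : E | G.source e = v}.Nonempty) :
    ∑ e ∈ hfin.toFinset, edge G R e * ghost G R e = vertex G R v :=
  Subtype.ext (by
    simpa [mkAlgHom_sym, vertex, edge, ghost] using rel_eq (Rel.ck2 (R := R) v hfin hne))

theorem ghost_mul_vertex_of_ne {v : V} {e : E} (h : G.source e ≠ v) :
    ghost G R e * vertex G R v = 0 := by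
  rw [← ghost_mul_source, mul_assoc, vertex_mul_of_ne G R h, mul_zero]

theorem ghost_mul_edge_mul_self (e : E) (x : LPA G R) :
    ghost G R e * (edge G R e * x) = vertex G R (G.range e) * x := by
  rw [← mul_assoc, ghost_mul_edge_self]

theorem ghost_mul_edge_mul_of_ne {e f : E} (h : e ≠ f) (x : LPA G R) :
    ghost G R e * (edge G R f * x) = 0 := by
  rw [← mul_assoc, ghost_mul_edge_of_ne G R h, zero_mul]

/-- To prove a property of all elements of `L_R(G)` it suffices to check generators. -/
theorem LPA.induction {p : LPA G R → Prop} (vert : ∀ v, p (vertex G R v))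
    (edg : ∀ e, p (edge G R e)) (gho : ∀ e, p (ghost G R e)) (zero : p 0)
    (add : ∀ x y, p x → p y → p (x + y)) (mul : ∀ x y, p x → p y → p (x * y))
    (smul : ∀ (r : R) x, p x → p (r • x)) (x : LPA G R) : p x := by
  obtain ⟨x, hx⟩ := x
  induction hx using NonUnitalAlgebra.adjoin_induction with
  | mem x hx =>
    obtain ⟨g, rfl⟩ := hx
    cases g with
    | vert v => exact vert v
    | edge e => exact edg e
    | ghost e => exact gho e
  | add x y hx hy h1 h2 => exact add _ _ h1 h2
  | zero => exact zero
  | mul x y hx hy h1 h2 => exact mul _ _ h1 h2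
  | smul r x hx h => exact smul r _ h

end Relations

/-! ### Multiplication of paths. -/

section Word

variable {V E : Type*} {G : DirectedMultigraph V E} (R : Type*) [CommRing R]

@[simp] theorem word_nil (v : V) : word G R v [] = vertex G R v := rfl

@[simp] theorem word_cons (v : V) (e : E) (l : List E) :
    word G R v (e :: l) = edge G R e * word G R (G.range e) l := rfl

theorem isPathFromTo_append {u v w : V} {l m : List E} (hl : G.IsPathFromTo u l v)
    (hm : G.IsPathFromTo v m w) : G.IsPathFromTo u (l ++ m) w := by
  induction l generalizing u with
  | nil => cases hl; exact hm
  | cons e l ih => exact ⟨hl.1, ih hl.2⟩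

theorem vertex_mul_word {u w : V} {l : List E} (hl : G.IsPathFromTo u l w) :
    vertex G R u * word G R u l = word G R u l := by
  cases l with
  | nil => exact vertex_mul_self G R u
  | cons e l => rw [word_cons, ← mul_assoc, ← hl.1, source_mul_edge]

theorem vertex_mul_word_of_ne {x u w : V} {l : List E} (hl : G.IsPathFromTo u l w) (h : x ≠ u) :
    vertex G R x * word G R u l = 0 := by
  rw [← vertex_mul_word R hl, ← mul_assoc, vertex_mul_of_ne G R h, zero_mul]

theorem word_append {u v : V} {l m : List E} {w : V} (hl : G.IsPathFromTo u l v)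
    (hm : G.IsPathFromTo v m w) :
    word G R u (l ++ m) = word G R u l * word G R v m := by
  induction l generalizing u with
  | nil => cases hl; exact (vertex_mul_word R hm).symm
  | cons e l ih => rw [List.cons_append, word_cons, word_cons, ih hl.2, mul_assoc]

theorem word_mul_vertex {u w : V} {l : List E} (hl : G.IsPathFromTo u l w) :
    word G R u l * vertex G R w = word G R u l := by
  have := word_append R hl (show G.IsPathFromTo w [] w from rfl)
  rw [List.append_nil] at this
  exact this.symm

theorem star_word_mul_word {u w : V} {l : List E} (hl : G.IsPathFromTo u l w) :
    star (word G R u l) * word G R u l = vertex G R w := by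
  induction l generalizing u with
  | nil => cases hl; rw [word_nil, star_vertex, vertex_mul_self]
  | cons e l ih =>
    rw [word_cons, star_mul, star_edge, mul_assoc, ghost_mul_edge_mul_self,
      vertex_mul_word R hl.2, ih hl.2]

theorem word_mul_edge {u : V} {f : E} {l : List E} (hl : G.IsPathFromTo u l (G.source f)) :
    word G R u l * edge G R f = word G R u (l ++ [f]) := by
  rw [word_append R hl (show G.IsPathFromTo (G.source f) [f] (G.range f) from ⟨rfl, rfl⟩),
    word_cons, word_nil, edge_mul_range]

/-- Without exits every vertex on the path emits a single edge, so the last relation reads `e e^* =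
s(e)` and the product collapses from the inside out. -/
theorem word_mul_star_word {u w : V} {l : List E} (hl : G.IsPathFromTo u l w)
    (hex : ∀ f ∈ l, ∀ e : E, G.source e = G.source f → e = f) :
    word G R u l * star (word G R u l) = vertex G R u := by
  induction l generalizing u with
  | nil => rw [word_nil, star_vertex, vertex_mul_self]
  | cons e l ih =>
    have hs : {f : E | G.source f = u} = {e} := by
      ext f
      simp only [Set.mem_ofPred_eq, Set.mem_singleton_iff]
      constructor
      · intro h; exact hex e (by simp) f (h.trans hl.1.symm)
      · rintro rfl; exact hl.1
    have hfin : {f : E | G.source f = u}.Finite := by rw [hs]; exact Set.finite_singleton e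
    have h := sum_edge_mul_ghost G R u hfin (by rw [hs]; exact Set.singleton_nonempty e)
    have hF : hfin.toFinset = {e} := by ext f; simp [hs]
    rw [hF, Finset.sum_singleton] at h
    rw [word_cons, star_mul, star_edge, mul_assoc, ← mul_assoc (word G R (G.range e) l),
      ih hl.2 (fun f hf => hex f (List.mem_cons_of_mem _ hf)), range_mul_ghost, h]

end Word

/-! ### A representation in which `r v` acts nontrivially. -/

section Representation

variable {V E : Type*} (G : DirectedMultigraph V E) (R : Type*) [CommRing R]

universe u

/-- An infinite set `κ` can be identified with `A × κ` for every nonempty set `A` which is not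
larger than `κ`. -/
theorem exists_prod_equiv {E : Type u} :
    ∃ κ : Type u, Nonempty κ ∧ ∀ A : Set E, A.Nonempty → Nonempty (κ ≃ A × κ) := by
  -- The summand `E` makes `κ` at least as large as any set of edges, and `ℕ` makes it infinite, so
  -- `|A| · |κ| = |κ|`.
  refine ⟨E ⊕ ULift ℕ, inferInstance, fun A hA => ?_⟩
  have : Nonempty A := hA.to_subtype
  have h : Cardinal.mk (A × (E ⊕ ULift.{u} ℕ)) = Cardinal.mk (E ⊕ ULift.{u} ℕ) := by
    rw [Cardinal.mk_prod, Cardinal.lift_id, Cardinal.lift_id]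
    refine Cardinal.mul_eq_right (Cardinal.aleph0_le_mk _) ?_ (Cardinal.mk_ne_zero _)
    exact (Cardinal.mk_set_le A).trans (Cardinal.mk_le_of_injective Sum.inl_injective)
  exact Cardinal.eq.mp h.symm

variable {G} in
/-- The action of the generators on functions on `V × κ`, for given maps which decompose an
element of `κ` at a vertex `v` into an edge starting at `v` and an element of `κ`. -/
noncomputable def actGen {κ : Type*} (hd : V → κ → E) (tl : V → κ → κ) (cons : E → κ → κ) :
    Gen V E → Module.End R (V × κ → R) :=
  open scoped Classical in
  fun g => match g with
  | .vert v =>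
    { toFun := fun f x => if x.1 = v then f x else 0
      map_add' := fun f g => by ext x; simp only [Pi.add_apply]; split_ifs <;> simp
      map_smul' := fun r f => by ext x; simp }
  | .edge e =>
    { toFun := fun f x => if G.source e = x.1 ∧ hd x.1 x.2 = e then
        f (G.range e, tl x.1 x.2) else 0
      map_add' := fun f g => by ext x; simp only [Pi.add_apply]; split_ifs <;> simp
      map_smul' := fun r f => by ext x; simp }
  | .ghost e =>
    { toFun := fun f x => if x.1 = G.range e then f (G.source e, cons e x.2) else 0
      map_add' := fun f g => by ext x; simp only [Pi.add_apply]; split_ifs <;> simp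
      map_smul' := fun r f => by ext x; simp }

variable {G R} in
-- A point `(v, k)` plays the role of an infinite path from `v` with first edge `hd v k`. The four
-- hypotheses say that, at a vertex emitting edges, `cons` and `(hd, tl)` are mutually inverse. In
-- the sum over the edges at `v` only the term of the first edge survives.
theorem lift_actGen_rel {κ : Type*} {hd : V → κ → E} {tl : V → κ → κ} {cons : E → κ → κ}
    (h1 : ∀ e k, hd (G.source e) (cons e k) = e) (h2 : ∀ e k, tl (G.source e) (cons e k) = k)
    (h3 : ∀ e k, G.source (hd (G.source e) k) = G.source e)
    (h4 : ∀ e k, cons (hd (G.source e) k) (tl (G.source e) k) = k)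
    ⦃x y : FreeAlgebra R (Gen V E)⦄ (h : Rel G R x y) :
    FreeAlgebra.lift R (actGen (G := G) R hd tl cons) x =
      FreeAlgebra.lift R (actGen (G := G) R hd tl cons) y := by
  cases h with
  | vert_idem v =>
    refine LinearMap.ext fun f => funext fun x => ?_
    simp only [sym, map_mul, FreeAlgebra.lift_ι_apply, actGen, Module.End.mul_apply,
      LinearMap.coe_mk, AddHom.coe_mk]
    split_ifs <;> rfl
  | vert_orth v w h =>
    refine LinearMap.ext fun f => funext fun x => ?_
    simp only [sym, map_mul, FreeAlgebra.lift_ι_apply, actGen, Module.End.mul_apply,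
      LinearMap.coe_mk, AddHom.coe_mk, map_zero, LinearMap.zero_apply, Pi.zero_apply]
    split_ifs <;> simp_all
  | source_edge e =>
    refine LinearMap.ext fun f => funext fun x => ?_
    simp only [sym, map_mul, FreeAlgebra.lift_ι_apply, actGen, Module.End.mul_apply,
      LinearMap.coe_mk, AddHom.coe_mk]
    split_ifs <;> simp_all
  | edge_range e =>
    refine LinearMap.ext fun f => funext fun x => ?_
    simp [sym, actGen]
  | range_ghost e =>
    refine LinearMap.ext fun f => funext fun x => ?_
    simp only [sym, map_mul, FreeAlgebra.lift_ι_apply, actGen, Module.End.mul_apply,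
      LinearMap.coe_mk, AddHom.coe_mk]
    split_ifs <;> simp_all
  | ghost_source e =>
    refine LinearMap.ext fun f => funext fun x => ?_
    simp [sym, actGen]
  | ck1_same e =>
    refine LinearMap.ext fun f => funext fun x => ?_
    simp only [sym, map_mul, FreeAlgebra.lift_ι_apply, actGen, Module.End.mul_apply,
      LinearMap.coe_mk, AddHom.coe_mk, h1, h2]
    obtain ⟨v, k⟩ := x
    by_cases h : v = G.range e <;> simp [h]
  | ck1_ne e f h =>
    refine LinearMap.ext fun g => funext fun x => ?_
    simp only [sym, map_mul, FreeAlgebra.lift_ι_apply, actGen, Module.End.mul_apply,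
      LinearMap.coe_mk, AddHom.coe_mk, map_zero, LinearMap.zero_apply, Pi.zero_apply]
    split_ifs with h5 h6
    · exact absurd ((h1 e x.2).symm.trans h6.2) h
    · rfl
    · rfl
  | ck2 v hfin hne =>
    refine LinearMap.ext fun g => funext fun x => ?_
    obtain ⟨e₀, rfl⟩ := hne
    obtain ⟨w, k⟩ := x
    simp only [sym, map_mul, map_sum, FreeAlgebra.lift_ι_apply, actGen, Module.End.mul_apply,
      LinearMap.coe_mk, AddHom.coe_mk, LinearMap.sum_apply, Finset.sum_apply, if_true]
    by_cases hw : w = G.source e₀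
    · subst hw
      rw [Finset.sum_eq_single (hd (G.source e₀) k)]
      · simp [h3, h4]
      · intro b _ hb
        rw [if_neg]
        rintro ⟨_, h⟩
        exact hb h.symm
      · intro h
        exact absurd (h3 e₀ k) (by simpa using h)
    · rw [if_neg hw]
      refine Finset.sum_eq_zero fun b hb => if_neg ?_
      rintro ⟨h, _⟩
      exact hw (h.symm.trans (by simpa using hb))

/-- A nonzero multiple of a vertex is nonzero in `L_R(G)`. -/
theorem eq_zero_of_smul_vertex_eq_zero {r : R} {v : V} (h : r • vertex G R v = 0) : r = 0 := by
  classical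
  obtain ⟨κ, ⟨k₀⟩, hκ⟩ := exists_prod_equiv (E := E)
  by_cases hE : Nonempty E
  swap
  -- Without edges `hd` has no possible value; here the algebra maps to functions on `V`, each
  -- vertex going to its indicator function.
  · have : IsEmpty E := not_nonempty_iff.mp hE
    let φ : Unital G R →ₐ[R] (V → R) := RingQuot.liftAlgHom R
      ⟨FreeAlgebra.lift R (fun g => match g with
        | .vert v => Pi.single v 1
        | .edge e => isEmptyElim e
        | .ghost e => isEmptyElim e), by
        intro x y h
        cases h with
        | vert_idem v => simp [sym, ← Pi.single_mul]
        | vert_orth v w h =>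
          ext x
          by_cases hx : x = v
          · subst hx; simp [sym, h]
          · simp [sym, hx]
        | ck2 v hfin hne => exact isEmptyElim hne.some
        | source_edge e => exact isEmptyElim e
        | edge_range e => exact isEmptyElim e
        | range_ghost e => exact isEmptyElim e
        | ghost_source e => exact isEmptyElim e
        | ck1_same e => exact isEmptyElim e
        | ck1_ne e => exact isEmptyElim e⟩
    have h1 : φ (r • gen G R (.vert v)) = 0 := by
      rw [show r • gen G R (.vert v) = 0 from congrArg Subtype.val h, map_zero]
    have h2 := congrFun h1 v
    rw [map_smul, gen, RingQuot.liftAlgHom_mkAlgHom_apply] at h2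
    simpa [sym] using h2
  have hκ' : ∀ v : V, {e : E | G.source e = v}.Nonempty →
      Nonempty (κ ≃ {e : E | G.source e = v} × κ) := fun v hv => hκ _ hv
  let θ : ∀ v : V, {e : E | G.source e = v}.Nonempty → (κ ≃ {e : E | G.source e = v} × κ) :=
    fun v hv => (hκ' v hv).some
  have ne : ∀ e, {f : E | G.source f = G.source e}.Nonempty := fun e => ⟨e, rfl⟩
  -- At a sink the default edge is harmless: an edge acts nontrivially only at points over its own
  -- source.
  let hd : V → κ → E := fun v k =>
    if hv : {e : E | G.source e = v}.Nonempty then (θ v hv k).1 else hE.some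
  let tl : V → κ → κ := fun v k =>
    if hv : {e : E | G.source e = v}.Nonempty then (θ v hv k).2 else k
  let cons : E → κ → κ := fun e k => (θ (G.source e) (ne e)).symm (⟨e, rfl⟩, k)
  -- `cons f` uses the bijection chosen at `s(f)`; this transports it to the equal vertex `s(e)`.
  have key : ∀ (e f : E) (h : G.source f = G.source e) (k : κ),
      cons f k = (θ (G.source e) (ne e)).symm (⟨f, h⟩, k) := by
    intro e f h k
    have : ∀ (v : V) (hv : {e : E | G.source e = v}.Nonempty) (h : G.source f = v),
      cons f k = (θ v hv).symm (⟨f, h⟩, k) := by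
      rintro v hv rfl; rfl
    exact this _ (ne e) h
  have h1 : ∀ e k, hd (G.source e) (cons e k) = e := by
    intro e k; simp only [hd, cons, dif_pos (ne e), Equiv.apply_symm_apply]
  have h2 : ∀ e k, tl (G.source e) (cons e k) = k := by
    intro e k; simp only [tl, cons, dif_pos (ne e), Equiv.apply_symm_apply]
  have h3 : ∀ e k, G.source (hd (G.source e) k) = G.source e := by
    intro e k
    simp only [hd, dif_pos (ne e)]
    exact (θ (G.source e) (ne e) k).1.2
  have h4 : ∀ e k, cons (hd (G.source e) k) (tl (G.source e) k) = k := by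
    intro e k
    rw [key e _ (h3 e k) _]
    simp only [hd, tl, dif_pos (ne e)]
    exact (θ (G.source e) (ne e)).symm_apply_apply k
  let φ : Unital G R →ₐ[R] Module.End R (V × κ → R) :=
    RingQuot.liftAlgHom R ⟨_, lift_actGen_rel (G := G) (R := R) h1 h2 h3 h4⟩
  have e1 : φ (r • gen G R (.vert v)) = 0 := by
    rw [show r • gen G R (.vert v) = 0 from congrArg Subtype.val h, map_zero]
  -- The constant function `1`, evaluated over `v` after the action of `r v`, returns `r`.
  have e2 := congrFun (LinearMap.congr_fun e1 (fun _ => 1)) (v, k₀)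
  rw [map_smul, gen, RingQuot.liftAlgHom_mkAlgHom_apply] at e2
  simpa [sym, actGen] using e2

end Representation

/-! ### The grading by length. -/

section Grading

variable {V E : Type*} (G : DirectedMultigraph V E) (R : Type*) [CommRing R]

/-- The degree of a generator. -/
def Gen.degree {V E : Type*} : Gen V E → ℤ
  | .vert _ => 0
  | .edge _ => 1
  | .ghost _ => -1

/-- The coaction which encodes the `ℤ`-grading of the Leavitt path algebra. -/
noncomputable def coaction : Unital G R →ₐ[R] AddMonoidAlgebra (Unital G R) ℤ :=
  RingQuot.liftAlgHom R ⟨FreeAlgebra.lift R fun g => .single g.degree (gen G R g), by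
    intro x y h
    have key : ∀ (n : ℤ) {x y : LPA G R}, x = y →
        AddMonoidAlgebra.single n (x : Unital G R) = AddMonoidAlgebra.single n (y : Unital G R) :=
      fun n x y h => by rw [h]
    cases h with
    | vert_idem v =>
      simp only [sym, map_mul, FreeAlgebra.lift_ι_apply,
        AddMonoidAlgebra.single_mul_single, Gen.degree, add_zero]
      exact key 0 (vertex_mul_self G R v)
    | vert_orth v w h =>
      simp only [sym, map_mul, map_zero, FreeAlgebra.lift_ι_apply,
        AddMonoidAlgebra.single_mul_single, Gen.degree, add_zero]
      exact (key 0 (vertex_mul_of_ne G R h)).trans (AddMonoidAlgebra.single_zero 0)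
    | source_edge e =>
      simp only [sym, map_mul, FreeAlgebra.lift_ι_apply,
        AddMonoidAlgebra.single_mul_single, Gen.degree, zero_add]
      exact key 1 (source_mul_edge G R e)
    | edge_range e =>
      simp only [sym, map_mul, FreeAlgebra.lift_ι_apply,
        AddMonoidAlgebra.single_mul_single, Gen.degree, add_zero]
      exact key 1 (edge_mul_range G R e)
    | range_ghost e =>
      simp only [sym, map_mul, FreeAlgebra.lift_ι_apply,
        AddMonoidAlgebra.single_mul_single, Gen.degree, zero_add]
      exact key (-1) (range_mul_ghost G R e)
    | ghost_source e =>
      simp only [sym, map_mul, FreeAlgebra.lift_ι_apply,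
        AddMonoidAlgebra.single_mul_single, Gen.degree, add_zero]
      exact key (-1) (ghost_mul_source G R e)
    | ck1_same e =>
      simp only [sym, map_mul, FreeAlgebra.lift_ι_apply,
        AddMonoidAlgebra.single_mul_single, Gen.degree, neg_add_cancel]
      exact key 0 (ghost_mul_edge_self G R e)
    | ck1_ne e f h =>
      simp only [sym, map_mul, map_zero, FreeAlgebra.lift_ι_apply,
        AddMonoidAlgebra.single_mul_single, Gen.degree, neg_add_cancel]
      exact (key 0 (ghost_mul_edge_of_ne G R h)).trans (AddMonoidAlgebra.single_zero 0)
    | ck2 v hfin hne =>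
      simp only [sym, map_mul, map_sum, FreeAlgebra.lift_ι_apply,
        AddMonoidAlgebra.single_mul_single, Gen.degree, add_neg_cancel]
      refine Eq.trans ?_ (key 0 (sum_edge_mul_ghost G R v hfin hne))
      rw [AddSubmonoidClass.coe_finsetSum]
      exact (map_sum (AddMonoidAlgebra.singleAddHom (0 : ℤ)) _ _).symm⟩

theorem coaction_gen (g : Gen V E) :
    coaction G R (gen G R g) = .single g.degree (gen G R g) := by
  rw [gen, coaction, RingQuot.liftAlgHom_mkAlgHom_apply]
  simp [sym, gen]

variable {G R} in
/-- `x` is homogeneous of degree `n`. -/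
def IsHomogeneousOf (n : ℤ) (x : LPA G R) : Prop :=
  coaction G R (x : Unital G R) = .single n (x : Unital G R)

theorem isHomogeneousOf_vertex (v : V) : IsHomogeneousOf 0 (vertex G R v) :=
  coaction_gen G R (.vert v)

theorem isHomogeneousOf_edge (e : E) : IsHomogeneousOf 1 (edge G R e) :=
  coaction_gen G R (.edge e)

theorem isHomogeneousOf_ghost (e : E) : IsHomogeneousOf (-1) (ghost G R e) :=
  coaction_gen G R (.ghost e)

variable {G R}

theorem IsHomogeneousOf.mul {m n : ℤ} {x y : LPA G R} (hx : IsHomogeneousOf m x)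
    (hy : IsHomogeneousOf n y) : IsHomogeneousOf (m + n) (x * y) := by
  unfold IsHomogeneousOf at *
  rw [NonUnitalSubalgebra.coe_mul, map_mul, hx, hy, AddMonoidAlgebra.single_mul_single]

theorem IsHomogeneousOf.smul {m : ℤ} {x : LPA G R} (hx : IsHomogeneousOf m x) (r : R) :
    IsHomogeneousOf m (r • x) := by
  unfold IsHomogeneousOf at *
  rw [NonUnitalSubalgebra.coe_smul, map_smul, hx, AddMonoidAlgebra.smul_single]

theorem isHomogeneousOf_word {u : V} {l : List E} :
    IsHomogeneousOf l.length (word G R u l) ∧ IsHomogeneousOf (-l.length) (star (word G R u l)) := by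
  induction l generalizing u with
  | nil => simpa [star_vertex] using isHomogeneousOf_vertex G R u
  | cons e l ih =>
    rw [word_cons, star_mul, star_edge]
    have h1 := (isHomogeneousOf_edge G R e).mul (ih (u := G.range e)).1
    have h2 := (ih (u := G.range e)).2.mul (isHomogeneousOf_ghost G R e)
    constructor
    · convert h1 using 1; rw [List.length_cons]; push_cast; ring
    · convert h2 using 1; rw [List.length_cons]; push_cast; ring

variable (G R) in
/-- The component of degree `n`. -/
noncomputable def component (n : ℤ) : LPA G R →ₗ[R] Unital G R where
  toFun x := (coaction G R (x : Unital G R)).coeff n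
  map_add' x y := by
    rw [NonUnitalSubalgebra.coe_add, map_add, AddMonoidAlgebra.coeff_add, Finsupp.add_apply]
  map_smul' r x := by
    rw [NonUnitalSubalgebra.coe_smul, map_smul, AddMonoidAlgebra.coeff_smul, Finsupp.smul_apply,
      RingHom.id_apply]

theorem IsHomogeneousOf.component_self {n : ℤ} {x : LPA G R} (hx : IsHomogeneousOf n x) :
    component G R n x = x := by
  change (coaction G R (x : Unital G R)).coeff n = _
  rw [hx, AddMonoidAlgebra.coeff_single, Finsupp.single_eq_same]

theorem IsHomogeneousOf.component_of_ne {m n : ℤ} {x : LPA G R} (hx : IsHomogeneousOf m x)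
    (h : m ≠ n) : component G R n x = 0 := by
  change (coaction G R (x : Unital G R)).coeff n = _
  rw [hx, AddMonoidAlgebra.coeff_single, Finsupp.single_eq_of_ne' h]

end Grading

end Leavitt

namespace Leavitt

/-! ### Surjective endomorphisms of Laurent polynomial rings. -/

section Hopfian

/-- The kernels of the powers of `f` stabilise at some `n`. An `x` in the kernel of `f` is `f ^ n`
of some `y`, and then `y` lies in the kernel of `f ^ (n + 1)`, hence in that of `f ^ n`. -/
theorem injective_of_surjective_of_isNoetherianRing {B : Type*} [CommRing B] [IsNoetherianRing B]
    (f : B →+* B) (hf : Function.Surjective f) : Function.Injective f := by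
  rw [injective_iff_map_eq_zero]
  intro x hx
  have hmono : Monotone fun n : ℕ => RingHom.ker (f ^ n) := by
    refine monotone_nat_of_le_succ fun n y hy => ?_
    rw [RingHom.mem_ker] at *
    rw [pow_succ', RingHom.mul_def, RingHom.comp_apply, hy, map_zero]
  obtain ⟨n, hn⟩ := monotone_stabilizes_iff_noetherian.mpr (inferInstance : IsNoetherian B B)
    ⟨_, hmono⟩
  have hs : Function.Surjective (f ^ n : B →+* B) := by
    rw [RingHom.coe_pow]
    exact hf.iterate n
  obtain ⟨y, rfl⟩ := hs x
  have h1 : y ∈ RingHom.ker (f ^ (n + 1)) := by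
    rw [RingHom.mem_ker, pow_succ', RingHom.mul_def, RingHom.comp_apply, hx]
  have h2 : RingHom.ker (f ^ n) = RingHom.ker (f ^ (n + 1)) := hn (n + 1) (Nat.le_succ n)
  rw [← h2, RingHom.mem_ker] at h1
  exact h1

variable {R : Type*} [CommRing R]

open LaurentPolynomial in
theorem mem_of_coeff_mem {S : Type*} [SetLike S R[T;T⁻¹]] [SubringClass S R[T;T⁻¹]] {B : S}
    (h1 : T 1 ∈ B) (h2 : T (-1) ∈ B)
    {f : R[T;T⁻¹]} (hf : ∀ n ∈ f.coeff.support, C (f.coeff n) ∈ B) : f ∈ B := by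
  have hT : ∀ n : ℤ, (T n : R[T;T⁻¹]) ∈ B := by
    intro n
    obtain ⟨m, rfl | rfl⟩ := n.eq_nat_or_neg
    · simpa [T_pow] using pow_mem h1 m
    · simpa [T_pow] using pow_mem h2 m
  have : f = ∑ n ∈ f.coeff.support, C (f.coeff n) * T n := by
    ext a
    simp_rw [← single_eq_C_mul_T]
    simp only [AddMonoidAlgebra.coeff_sum, AddMonoidAlgebra.coeff_single, Finsupp.finsetSum_apply]
    rw [Finset.sum_eq_single a]
    · simp
    · intro b _ hb
      exact Finsupp.single_eq_of_ne' hb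
    · intro ha
      rw [Finsupp.single_eq_same, Finsupp.notMem_support_iff.mp ha]
  rw [this]
  exact sum_mem fun n hn => mul_mem (hf n hn) (hT n)

open LaurentPolynomial in
/-- The `R`-algebra of Laurent polynomials is Hopfian. -/
theorem laurent_injective_of_surjective (θ : R[T;T⁻¹] →ₐ[R] R[T;T⁻¹])
    (hθ : Function.Surjective θ) : Function.Injective θ := by
  classical
  rw [injective_iff_map_eq_zero]
  intro q hq
  obtain ⟨a, ha⟩ := hθ (T 1)
  obtain ⟨b, hb⟩ := hθ (T (-1))
  -- `R` need not be Noetherian, so the problem is moved to a finitely generated subring `B`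
  -- containing `q`. It contains the coefficients of the images of `T` and `T⁻¹`, which makes `B`
  -- stable under `θ`, and those of their preimages `a` and `b`, which makes `θ` surjective on `B`.
  -- The adjoined coefficients are fixed by `θ`.
  let F : Finset R[T;T⁻¹] := {θ (T 1), θ (T (-1)), a, b, q}
  let c : Finset R[T;T⁻¹] := F.biUnion fun f => f.coeff.support.image fun n => C (f.coeff n)
  let B : Subalgebra ℤ R[T;T⁻¹] :=
    Algebra.adjoin ℤ (({T 1, T (-1)} ∪ c : Finset R[T;T⁻¹]) : Set R[T;T⁻¹])
  have hsub : ∀ x ∈ ({T 1, T (-1)} ∪ c : Finset R[T;T⁻¹]), x ∈ B := fun x hx =>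
    Algebra.subset_adjoin hx
  have hT1 : T 1 ∈ B := hsub _ (by simp)
  have hT2 : T (-1) ∈ B := hsub _ (by simp)
  have hF : ∀ f ∈ F, f ∈ B := fun f hf => mem_of_coeff_mem hT1 hT2 fun n hn =>
    hsub _ (Finset.mem_union_right _ (Finset.mem_biUnion.mpr
      ⟨f, hf, Finset.mem_image_of_mem _ hn⟩))
  have hC : ∀ x ∈ c, θ x = x := by
    intro x hx
    obtain ⟨f, _, hx⟩ := Finset.mem_biUnion.mp hx
    obtain ⟨n, _, rfl⟩ := Finset.mem_image.mp hx
    rw [C_eq_algebraMap, AlgHom.commutes]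
  let θ' : R[T;T⁻¹] →ₐ[ℤ] R[T;T⁻¹] := θ.restrictScalars ℤ
  have hmap : ∀ x ∈ B, θ' x ∈ B := by
    have : B ≤ B.comap θ' := by
      refine Algebra.adjoin_le fun x hx => ?_
      change θ x ∈ B
      rcases Finset.mem_union.mp (Finset.mem_coe.mp hx) with h | h
      · rcases Finset.mem_insert.mp h with rfl | h
        · exact hF _ (by simp [F])
        · rw [Finset.mem_singleton.mp h]
          exact hF _ (by simp [F])
      · rw [hC x h]; exact hsub x hx
    exact this
  let φ : B →ₐ[ℤ] B := (θ'.comp B.val).codRestrict B fun x => hmap x x.2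
  have hφ : Function.Surjective φ := by
    have : B ≤ φ.range.map B.val := by
      refine Algebra.adjoin_le fun x hx => ?_
      rcases Finset.mem_union.mp (Finset.mem_coe.mp hx) with h | h
      · rcases Finset.mem_insert.mp h with rfl | h
        · exact ⟨φ ⟨a, hF a (by simp [F])⟩, ⟨_, rfl⟩, ha⟩
        · rw [Finset.mem_singleton.mp h]
          exact ⟨φ ⟨b, hF b (by simp [F])⟩, ⟨_, rfl⟩, hb⟩
      · exact ⟨φ ⟨x, hsub x hx⟩, ⟨_, rfl⟩, hC x h⟩
    intro x
    obtain ⟨y, ⟨z, rfl⟩, hy⟩ := this x.2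
    exact ⟨z, Subtype.ext hy⟩
  have : Algebra.FiniteType ℤ B := (Subalgebra.fg_iff_finiteType B).mp ⟨_, rfl⟩
  have : IsNoetherianRing B := Algebra.FiniteType.isNoetherianRing ℤ B
  have hinj := injective_of_surjective_of_isNoetherianRing φ.toRingHom hφ
  have hqB : q ∈ B := hF q (by simp [F])
  have : (⟨q, hqB⟩ : B) = 0 := hinj (by
    rw [map_zero]
    exact Subtype.ext hq)
  exact congrArg Subtype.val this

/-- A surjective endomorphism of the ring of Laurent polynomials which is `R`-linear, but not
assumed to be unital, is injective. -/
theorem laurent_injective_of_surjective_of_smul (θ : R[T;T⁻¹] →ₙ+* R[T;T⁻¹])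
    (hsmul : ∀ (r : R) f, θ (r • f) = r • θ f)
    (hθ : Function.Surjective θ) : Function.Injective θ := by
  -- Surjectivity forces unitality: `θ 1` is an identity for the range of `θ`.
  have h1 : θ 1 = 1 := by
    obtain ⟨u, hu⟩ := hθ 1
    calc θ 1 = θ 1 * θ u := by rw [hu, mul_one]
      _ = 1 := by rw [← map_mul, one_mul, hu]
  let θ' : R[T;T⁻¹] →ₐ[R] R[T;T⁻¹] := AlgHom.ofLinearMap
    { toFun := θ, map_add' := map_add θ, map_smul' := hsmul } h1 (map_mul θ)
  exact laurent_injective_of_surjective θ' hθ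

end Hopfian

/-! ### Integral powers relative to an idempotent. -/

section Powers

variable {R L : Type*} [CommRing R] [NonUnitalRing L]

/-- For an element `a` with inverse `b` relative to an idempotent `p`, the unit `a + (1 - p)` of
the unitization. -/
def unitizationUnit (a b p : L) (hab : a * b = p) (hba : b * a = p) (hpa : p * a = a)
    (hap : a * p = a) (hpb : p * b = b) (hbp : b * p = b) : (Unitization ℤ L)ˣ where
  val := Unitization.inr a + (1 - Unitization.inr p)
  inv := Unitization.inr b + (1 - Unitization.inr p)
  val_inv := by
    have hpp : p * p = p := by rw [← hab, mul_assoc, ← mul_assoc b, hba, hpb]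
    simp only [add_mul, mul_add, sub_mul, mul_sub, one_mul, mul_one, ← Unitization.inr_mul, hab,
      hap, hpb, hpp]
    abel
  inv_val := by
    have hpp : p * p = p := by rw [← hab, mul_assoc, ← mul_assoc b, hba, hpb]
    simp only [add_mul, mul_add, sub_mul, mul_sub, one_mul, mul_one, ← Unitization.inr_mul, hba,
      hbp, hpa, hpp]
    abel

theorem mul_mul_of_commute {A : Type*} [Semigroup A] {p x : A} (hp : p * p = p) (h : Commute p x)
    (y : A) : p * (x * y) = p * x * (p * y) := by
  rw [h.eq, mul_assoc, ← mul_assoc p p, hp, ← mul_assoc, h.eq, mul_assoc]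

/-- If `a` has the inverse `b` relative to an idempotent, there are integral powers of `a`. -/
theorem exists_zpowers {a b p : L} (hab : a * b = p) (hba : b * a = p) (hpa : p * a = a)
    (hap : a * p = a) (hpb : p * b = b) (hbp : b * p = b) :
    ∃ z : ℤ → L, (∀ m n, z (m + n) = z m * z n) ∧ z 0 = p ∧ z 1 = a ∧ z (-1) = b := by
  have hpp : p * p = p := by rw [← hab, mul_assoc, ← mul_assoc b, hba, hpb]
  obtain ⟨w, hw⟩ : ∃ w : (Unitization ℤ L)ˣ, w = unitizationUnit a b p hab hba hpa hap hpb hbp :=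
    ⟨_, rfl⟩
  have hw1 : (w : Unitization ℤ L) = Unitization.inr a + (1 - Unitization.inr p) := by
    rw [hw]; rfl
  have hw2 : ((w⁻¹ : (Unitization ℤ L)ˣ) : Unitization ℤ L) =
      Unitization.inr b + (1 - Unitization.inr p) := by
    rw [hw]; rfl
  have hcomm : Commute (Unitization.inr p : Unitization ℤ L) w := by
    rw [hw1, Commute, SemiconjBy]
    simp only [add_mul, mul_add, sub_mul, mul_sub, one_mul, mul_one, ← Unitization.inr_mul, hap,
      hpa, hpp]
  -- `L` is an ideal of the unitization, so `p w ^ n` lies in `L`; it is the power sought, the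
  -- factor `p` removing the summand `1 - p` of `w`.
  have hz : ∀ n : ℤ, ∃ x : L, Unitization.inr p * ((w ^ n : (Unitization ℤ L)ˣ) : Unitization ℤ L) =
      Unitization.inr x := by
    intro n
    let y : Unitization ℤ L := Unitization.inr p * ((w ^ n : (Unitization ℤ L)ˣ) : Unitization ℤ L)
    exact ⟨y.snd, Unitization.ext (by simp) rfl⟩
  choose z hz using hz
  have hinj : Function.Injective (Unitization.inr : L → Unitization ℤ L) :=
    Unitization.inr_injective
  refine ⟨z, fun m n => hinj ?_, hinj ?_, hinj ?_, hinj ?_⟩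
  · have hc : Commute (Unitization.inr p : Unitization ℤ L)
        ((w ^ m : (Unitization ℤ L)ˣ) : Unitization ℤ L) := hcomm.units_zpow_right m
    rw [Unitization.inr_mul, ← hz, ← hz, ← hz, zpow_add, Units.val_mul]
    exact mul_mul_of_commute (by rw [← Unitization.inr_mul, hpp]) hc _
  · rw [← hz, zpow_zero, Units.val_one, mul_one]
  · rw [← hz, zpow_one, hw1, mul_add, mul_sub, mul_one, ← Unitization.inr_mul,
      ← Unitization.inr_mul, hpa, hpp, sub_self, add_zero]
  · rw [← hz, zpow_neg_one, hw2, mul_add, mul_sub, mul_one, ← Unitization.inr_mul,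
      ← Unitization.inr_mul, hpb, hpp, sub_self, add_zero]

variable [Module R L] [IsScalarTower R L L] [SMulCommClass R L L]

variable (R) in
/-- The homomorphism from Laurent polynomials determined by integral powers. -/
noncomputable def laurentLift (z : ℤ → L) (hz : ∀ m n, z (m + n) = z m * z n) :
    R[T;T⁻¹] →ₙₐ[R] L :=
  AddMonoidAlgebra.liftMagma R
    { toFun := fun n => z n.toAdd, map_mul' := fun m n => hz m.toAdd n.toAdd }

theorem laurentLift_apply (z : ℤ → L) (hz : ∀ m n, z (m + n) = z m * z n) (f : R[T;T⁻¹]) :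
    laurentLift R z hz f = ∑ n ∈ f.coeff.support, f.coeff n • z n := by
  simp [laurentLift, Finsupp.sum]

theorem laurentLift_single (z : ℤ → L) (hz : ∀ m n, z (m + n) = z m * z n) (n : ℤ) (r : R) :
    laurentLift R z hz (.single n r) = r • z n := by
  simp [laurentLift, -LaurentPolynomial.single_eq_C_mul_T]

theorem range_laurentLift (z : ℤ → L) (hz : ∀ m n, z (m + n) = z m * z n) :
    NonUnitalAlgHom.range (laurentLift R z hz) = NonUnitalAlgebra.adjoin R {z 1, z (-1)} := by
  apply le_antisymm
  · rintro _ ⟨f, rfl⟩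
    change laurentLift R z hz f ∈ _
    rw [laurentLift_apply]
    have h1 : z 1 ∈ NonUnitalAlgebra.adjoin R {z 1, z (-1)} :=
      NonUnitalAlgebra.subset_adjoin R (by simp)
    have h2 : z (-1) ∈ NonUnitalAlgebra.adjoin R {z 1, z (-1)} :=
      NonUnitalAlgebra.subset_adjoin R (by simp)
    refine sum_mem fun n hn => SMulMemClass.smul_mem _ ?_
    clear hn
    induction n using Int.induction_on with
    | zero => rw [← add_neg_cancel (1 : ℤ), hz]; exact mul_mem h1 h2
    | succ n ih => rw [hz]; exact mul_mem ih h1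
    | pred n ih => rw [sub_eq_add_neg, hz]; exact mul_mem ih h2
  · refine NonUnitalAlgebra.adjoin_le ?_
    rintro x (rfl | rfl)
    · exact ⟨.single 1 1, by rw [← one_smul R (z 1)]; exact laurentLift_single z hz 1 1⟩
    · exact ⟨.single (-1) 1, by rw [← one_smul R (z (-1))]; exact laurentLift_single z hz (-1) 1⟩

theorem laurentLift_invert [StarRing L] (hstar : ∀ (r : R) (x : L), star (r • x) = r • star x)
    (z : ℤ → L) (hz : ∀ m n, z (m + n) = z m * z n) (h1 : star (z 1) = z (-1)) (f : R[T;T⁻¹]) :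
    laurentLift R z hz (LaurentPolynomial.invert f) = star (laurentLift R z hz f) := by
  have h1' : star (z (-1)) = z 1 := by rw [← h1, star_star]
  have hs : ∀ n, star (z n) = z (-n) := by
    intro n
    induction n using Int.induction_on with
    | zero => rw [neg_zero, ← add_neg_cancel (1 : ℤ), hz, star_mul, h1, h1']
    | succ n ih => rw [hz, star_mul, ih, h1, ← hz]; congr 1; ring
    | pred n ih => rw [sub_eq_add_neg, hz, star_mul, ih, h1', ← hz]; congr 1; ring
  induction f using LaurentPolynomial.induction_on' with
  | add p q hp hq => rw [map_add, map_add, map_add, star_add, hp, hq]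
  | C_mul_T n a =>
    rw [map_mul, LaurentPolynomial.invert_C, LaurentPolynomial.invert_T,
      ← LaurentPolynomial.single_eq_C_mul_T, ← LaurentPolynomial.single_eq_C_mul_T,
      laurentLift_single, laurentLift_single, hstar, hs]

end Powers

end Leavitt

namespace Leavitt

open DirectedMultigraph

/-! ### Normal forms `∑ α β^*` and the removal of ghost edges. -/

section RealPolynomials

variable {V E : Type*} (G : DirectedMultigraph V E) (R : Type*) [CommRing R]

/-- The span of the paths ending at `v`. -/
def realPoly (v : V) : Submodule R (LPA G R) :=
  Submodule.span R ((fun t : V × List E => word G R t.1 t.2) '' {t | G.IsPathFromTo t.1 t.2 v})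

/-- Linear combinations of elements `α β^*`, where `s(β) = v` and the length of `β` is at
most `n`. -/
def ghostForm : ℕ → V → Submodule R (LPA G R)
  | 0, v => realPoly G R v
  | n + 1, v => realPoly G R v ⊔ Submodule.span R
      {x | ∃ e, ∃ y ∈ ghostForm n (G.range e), G.source e = v ∧ x = y * ghost G R e}

variable {G R}

theorem word_mem_realPoly {u v : V} {l : List E} (h : G.IsPathFromTo u l v) :
    word G R u l ∈ realPoly G R v :=
  Submodule.subset_span ⟨(u, l), h, rfl⟩

theorem isPathFromTo_snoc {u : V} {l : List E} {e : E} (h : G.IsPathFromTo u l (G.source e)) :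
    G.IsPathFromTo u (l ++ [e]) (G.range e) :=
  isPathFromTo_append h ⟨rfl, rfl⟩

theorem mul_edge_mem_realPoly {e : E} {z : LPA G R} (hz : z ∈ realPoly G R (G.source e)) :
    z * edge G R e ∈ realPoly G R (G.range e) := by
  induction hz using Submodule.span_induction with
  | mem x hx =>
    obtain ⟨⟨u, l⟩, hl, rfl⟩ := hx
    simp only [word_mul_edge R hl]
    exact word_mem_realPoly (isPathFromTo_snoc hl)
  | zero => rw [zero_mul]; exact zero_mem _
  | add x y _ _ hx hy => rw [add_mul]; exact add_mem hx hy
  | smul r x _ hx => rw [smul_mul_assoc]; exact Submodule.smul_mem _ r hx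

theorem mul_vertex_of_mem_realPoly {v : V} {z : LPA G R} (hz : z ∈ realPoly G R v) :
    z * vertex G R v = z := by
  induction hz using Submodule.span_induction with
  | mem x hx =>
    obtain ⟨⟨u, l⟩, hl, rfl⟩ := hx
    exact word_mul_vertex R hl
  | zero => rw [zero_mul]
  | add x y _ _ hx hy => rw [add_mul, hx, hy]
  | smul r x _ hx => rw [smul_mul_assoc, hx]

theorem realPoly_le_ghostForm (n : ℕ) (v : V) : realPoly G R v ≤ ghostForm G R n v := by
  cases n with
  | zero => exact le_rfl
  | succ n => exact le_sup_left

theorem mul_ghost_mem_ghostForm {n : ℕ} {e : E} {y : LPA G R}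
    (hy : y ∈ ghostForm G R n (G.range e)) :
    y * ghost G R e ∈ ghostForm G R (n + 1) (G.source e) :=
  le_sup_right (a := realPoly G R (G.source e)) (Submodule.subset_span ⟨e, y, hy, rfl, rfl⟩)

/-- The induction principle for `ghostForm`: with `M` a preimage or an equalizer of linear maps,
linear statements reduce to generators. -/
theorem ghostForm_le_iff {n : ℕ} {v : V} {M : Submodule R (LPA G R)} :
    ghostForm G R (n + 1) v ≤ M ↔ realPoly G R v ≤ M ∧
      ∀ e, G.source e = v → ∀ y ∈ ghostForm G R n (G.range e), y * ghost G R e ∈ M := by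
  rw [ghostForm, sup_le_iff, Submodule.span_le]
  refine and_congr_right fun _ => ⟨fun h e he y hy => h ⟨e, y, hy, he, rfl⟩, ?_⟩
  rintro h _ ⟨e, y, hy, he, rfl⟩
  exact h e he y hy

theorem ghostForm_mono_succ (n : ℕ) (v : V) : ghostForm G R n v ≤ ghostForm G R (n + 1) v := by
  induction n generalizing v with
  | zero => exact realPoly_le_ghostForm 1 v
  | succ n ih =>
    rw [ghostForm_le_iff]
    refine ⟨realPoly_le_ghostForm _ v, ?_⟩
    rintro e rfl y hy
    exact mul_ghost_mem_ghostForm (ih _ hy)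

theorem ghostForm_mono (v : V) : Monotone fun n => ghostForm G R n v :=
  monotone_nat_of_le_succ fun n => ghostForm_mono_succ n v

/-- Left multiplication does not touch the ghost edges on the right, so its effect on real paths
decides. One extra ghost edge must be allowed, because `e^*` times a vertex may be `e^*`. -/
theorem mul_mem_ghostForm_of_word {g : LPA G R}
    (hg : ∀ u l v, G.IsPathFromTo u l v → g * word G R u l ∈ ghostForm G R 1 v) {n : ℕ} {v : V}
    {y : LPA G R} (hy : y ∈ ghostForm G R n v) : g * y ∈ ghostForm G R (n + 1) v := by
  have h0 : ∀ v, realPoly G R v ≤ (ghostForm G R 1 v).comap (LinearMap.mulLeft R g) := by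
    intro v
    refine Submodule.span_le.mpr ?_
    rintro _ ⟨⟨u, l⟩, hl, rfl⟩
    exact hg u l v hl
  suffices ghostForm G R n v ≤ (ghostForm G R (n + 1) v).comap (LinearMap.mulLeft R g) from this hy
  clear hy
  induction n generalizing v with
  | zero => exact h0 v
  | succ n ih =>
    rw [ghostForm_le_iff]
    refine ⟨(h0 v).trans (Submodule.comap_mono (ghostForm_mono v (by omega))), ?_⟩
    rintro e rfl y hy
    rw [Submodule.mem_comap, LinearMap.mulLeft_apply, ← mul_assoc]
    exact mul_ghost_mem_ghostForm (ih hy)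

theorem vertex_mul_word_mem (x u : V) (l : List E) (v : V) (h : G.IsPathFromTo u l v) :
    vertex G R x * word G R u l ∈ ghostForm G R 1 v := by
  by_cases hx : x = u
  · subst hx
    rw [vertex_mul_word R h]
    exact realPoly_le_ghostForm 1 v (word_mem_realPoly h)
  · rw [vertex_mul_word_of_ne R h hx]
    exact zero_mem _

theorem edge_mul_word_mem (e : E) (u : V) (l : List E) (v : V) (h : G.IsPathFromTo u l v) :
    edge G R e * word G R u l ∈ ghostForm G R 1 v := by
  by_cases hx : G.range e = u
  · subst hx
    exact realPoly_le_ghostForm 1 v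
      (word_mem_realPoly (u := G.source e) (l := e :: l) ⟨rfl, h⟩)
  · rw [← edge_mul_range, mul_assoc, vertex_mul_word_of_ne R h hx, mul_zero]
    exact zero_mem _

theorem ghost_mul_word_mem (e : E) (u : V) (l : List E) (v : V) (h : G.IsPathFromTo u l v) :
    ghost G R e * word G R u l ∈ ghostForm G R 1 v := by
  cases l with
  | nil =>
    obtain rfl : u = v := h
    by_cases hx : G.source e = u
    · subst hx
      rw [word_nil, ghost_mul_source, ← range_mul_ghost]
      exact mul_ghost_mem_ghostForm
        (word_mem_realPoly (u := G.range e) (l := []) rfl)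
    · rw [word_nil, ghost_mul_vertex_of_ne G R hx]
      exact zero_mem _
  | cons f l =>
    rw [word_cons]
    by_cases hx : e = f
    · subst hx
      rw [ghost_mul_edge_mul_self, vertex_mul_word R h.2]
      exact realPoly_le_ghostForm 1 v (word_mem_realPoly h.2)
    · rw [ghost_mul_edge_mul_of_ne G R hx]
      exact zero_mem _

theorem exists_mul_mem_ghostForm (x : LPA G R) {n : ℕ} {v : V} {y : LPA G R}
    (hy : y ∈ ghostForm G R n v) : ∃ m, x * y ∈ ghostForm G R m v := by
  induction x using LPA.induction generalizing n y with
  | vert u => exact ⟨n + 1, mul_mem_ghostForm_of_word (vertex_mul_word_mem u) hy⟩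
  | edg e => exact ⟨n + 1, mul_mem_ghostForm_of_word (edge_mul_word_mem e) hy⟩
  | gho e => exact ⟨n + 1, mul_mem_ghostForm_of_word (ghost_mul_word_mem e) hy⟩
  | zero => exact ⟨0, by rw [zero_mul]; exact zero_mem _⟩
  | add a b ha hb =>
    obtain ⟨m, hm⟩ := ha hy
    obtain ⟨k, hk⟩ := hb hy
    refine ⟨max m k, ?_⟩
    rw [add_mul]
    exact add_mem (ghostForm_mono v (le_max_left m k) hm) (ghostForm_mono v (le_max_right m k) hk)
  | mul a b ha hb =>
    obtain ⟨m, hm⟩ := hb hy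
    obtain ⟨k, hk⟩ := ha hm
    exact ⟨k, by rwa [mul_assoc]⟩
  | smul r a ha =>
    obtain ⟨m, hm⟩ := ha hy
    exact ⟨m, by rw [smul_mul_assoc]; exact Submodule.smul_mem _ r hm⟩

theorem exists_mul_vertex_mem_ghostForm (x : LPA G R) (v : V) :
    ∃ n, x * vertex G R v ∈ ghostForm G R n v :=
  exists_mul_mem_ghostForm (n := 0) x (word_mem_realPoly (u := v) (l := []) rfl)

/-- A term without ghosts becomes a longer real path. In a term `y f^*` the factor `f^* e` is zero
or `r(e)`, so one ghost edge disappears. -/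
theorem mul_edge_mem_ghostForm {n : ℕ} {e : E} {x : LPA G R}
    (hx : x ∈ ghostForm G R (n + 1) (G.source e)) :
    x * edge G R e ∈ ghostForm G R n (G.range e) := by
  suffices ghostForm G R (n + 1) (G.source e) ≤
    (ghostForm G R n (G.range e)).comap (LinearMap.mulRight R (edge G R e)) from this hx
  rw [ghostForm_le_iff]
  refine ⟨fun z hz => realPoly_le_ghostForm _ _ (mul_edge_mem_realPoly hz), ?_⟩
  intro f hf y hy
  rw [Submodule.mem_comap, LinearMap.mulRight_apply, mul_assoc]
  by_cases h : f = e
  · subst h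
    rw [ghost_mul_edge_self]
    suffices ∀ n v, ∀ y ∈ ghostForm G R n v, y * vertex G R v = y by
      rw [this n _ y hy]; exact hy
    intro n v y hy
    cases n with
    | zero => exact mul_vertex_of_mem_realPoly hy
    | succ n =>
      suffices ghostForm G R (n + 1) v ≤
        LinearMap.eqLocus (LinearMap.mulRight R (vertex G R v)) LinearMap.id from this hy
      rw [ghostForm_le_iff]
      refine ⟨fun z hz => mul_vertex_of_mem_realPoly hz, ?_⟩
      rintro e rfl y _
      change y * ghost G R e * vertex G R _ = y * ghost G R e
      rw [mul_assoc, ghost_mul_source]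
  · rw [ghost_mul_edge_of_ne G R h, mul_zero]
    exact zero_mem _

/-- Up to a real polynomial, an element of `L_R(G) v` can be recovered from its products with the
edges starting at `v`. -/
theorem exists_realPoly_sub_eq {n : ℕ} {v : V} {x : LPA G R} (hx : x ∈ ghostForm G R n v) :
    ∃ z ∈ realPoly G R v, ∃ F : Finset E, (∀ e ∈ F, G.source e = v) ∧
      ∀ F' : Finset E, F ⊆ F' →
        x + ∑ e ∈ F', z * edge G R e * ghost G R e =
          z + ∑ e ∈ F', x * edge G R e * ghost G R e := by
  classical
  cases n with
  | zero => exact ⟨x, hx, ∅, by simp, fun _ _ => rfl⟩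
  | succ n =>
    obtain ⟨z, hz, y, hy, rfl⟩ := Submodule.mem_sup.mp hx
    -- The contributions of `z` on both sides agree. The ghost part `y` is a finite sum of terms `y'
    -- f^*`, and right multiplication by `∑ e e^*` fixes it once all these `f` are included.
    suffices ∃ F : Finset E, (∀ e ∈ F, G.source e = v) ∧ ∀ F' : Finset E, F ⊆ F' →
        ∑ e ∈ F', y * edge G R e * ghost G R e = y by
      obtain ⟨F, hF, h⟩ := this
      refine ⟨z, hz, F, hF, fun F' hF' => ?_⟩
      simp only [add_mul, Finset.sum_add_distrib, h F' hF']
      abel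
    clear hx hz
    induction hy using Submodule.span_induction with
    | mem x hx =>
      obtain ⟨f, y, _, hf, rfl⟩ := hx
      refine ⟨{f}, by simpa using hf, fun F' hF' => ?_⟩
      rw [Finset.sum_eq_single f]
      · rw [mul_assoc y, ghost_mul_edge_self, mul_assoc, range_mul_ghost]
      · intro e _ he
        rw [mul_assoc y, ghost_mul_edge_of_ne G R (Ne.symm he), mul_zero, zero_mul]
      · intro h
        exact absurd (hF' (Finset.mem_singleton_self f)) h
    | zero => exact ⟨∅, by simp, by simp⟩
    | add a b _ _ ha hb =>
      obtain ⟨F₁, h₁, h₁'⟩ := ha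
      obtain ⟨F₂, h₂, h₂'⟩ := hb
      refine ⟨F₁ ∪ F₂, fun e he => (Finset.mem_union.mp he).elim (h₁ e) (h₂ e), fun F' hF' => ?_⟩
      simp only [add_mul, Finset.sum_add_distrib]
      rw [h₁' F' (Finset.union_subset_left hF'), h₂' F' (Finset.union_subset_right hF')]
    | smul r a _ ha =>
      obtain ⟨F, h, h'⟩ := ha
      refine ⟨F, h, fun F' hF' => ?_⟩
      simp only [smul_mul_assoc]
      rw [← Finset.smul_sum, h' F' hF']

/-- Finite sums of vertices act as local units, replacing the identity that `L_R(E)` may lack. -/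
theorem exists_mul_sum_vertex_eq (x : LPA G R) :
    ∃ F : Finset V, ∀ F' : Finset V, F ⊆ F' → x * ∑ v ∈ F', vertex G R v = x := by
  classical
  have key : ∀ (x : LPA G R) (v : V), x * vertex G R v = x →
      ∃ F : Finset V, ∀ F' : Finset V, F ⊆ F' → x * ∑ v ∈ F', vertex G R v = x := by
    intro x v hx
    refine ⟨{v}, fun F' hF' => ?_⟩
    rw [← hx, mul_assoc, Finset.mul_sum, Finset.sum_eq_single v, vertex_mul_self]
    · exact fun w _ hw => vertex_mul_of_ne G R (Ne.symm hw)
    · exact fun h => absurd (hF' (Finset.mem_singleton_self v)) h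
  induction x using LPA.induction with
  | vert v => exact key _ v (vertex_mul_self G R v)
  | edg e => exact key _ _ (edge_mul_range G R e)
  | gho e => exact key _ _ (ghost_mul_source G R e)
  | zero => exact ⟨∅, by simp⟩
  | add a b ha hb =>
    obtain ⟨F₁, h₁⟩ := ha
    obtain ⟨F₂, h₂⟩ := hb
    refine ⟨F₁ ∪ F₂, fun F' hF' => ?_⟩
    rw [add_mul, h₁ F' (Finset.union_subset_left hF'), h₂ F' (Finset.union_subset_right hF')]
  | mul a b _ hb =>
    obtain ⟨F, h⟩ := hb
    exact ⟨F, fun F' hF' => by rw [mul_assoc, h F' hF']⟩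
  | smul r a ha =>
    obtain ⟨F, h⟩ := ha
    exact ⟨F, fun F' hF' => by rw [smul_mul_assoc, h F' hF']⟩

theorem exists_mul_vertex_ne_zero {x : LPA G R} (hx : x ≠ 0) : ∃ v, x * vertex G R v ≠ 0 := by
  by_contra! h
  obtain ⟨F, hF⟩ := exists_mul_sum_vertex_eq x
  apply hx
  rw [← hF F subset_rfl, Finset.mul_sum]
  exact Finset.sum_eq_zero fun v _ => h v

end RealPolynomials

/-! ### Combinations of a vertex and closed paths. -/

section ClosedSums

variable {V E : Type*} {G : DirectedMultigraph V E} {R : Type*}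

variable (G) in
/-- All paths in the list are closed paths at `v` of positive length. -/
def AreClosedAt (v : V) (p : List (R × List E)) : Prop :=
  ∀ t ∈ p, t.2 ≠ [] ∧ G.IsPathFromTo v t.2 v

variable [CommRing R]

variable (G) in
/-- The linear combination of paths starting at `v` with the given coefficients. -/
def evalAt (v : V) (p : List (R × List E)) : LPA G R :=
  (p.map fun t => t.1 • word G R v t.2).sum

/-- Edges cancel one at a time. A mismatch gives zero; otherwise `l` is an initial segment of `l'`,
and the rest is closed because both paths end at `v`, and nonempty because they differ. -/
theorem star_word_mul_word_eq_zero_or {v u u' : V} {l l' : List E} (h : G.IsPathFromTo u l v)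
    (h' : G.IsPathFromTo u' l' v) (hlen : l.length ≤ l'.length) (hne : (u, l) ≠ (u', l')) :
    star (word G R u l) * word G R u' l' = 0 ∨
      ∃ m : List E, m ≠ [] ∧ G.IsPathFromTo v m v ∧
        star (word G R u l) * word G R u' l' = word G R v m := by
  induction l generalizing u u' l' with
  | nil =>
    obtain rfl : u = v := h
    rw [word_nil, star_vertex]
    by_cases hu : u = u'
    · subst hu
      refine Or.inr ⟨l', ?_, h', vertex_mul_word R h'⟩
      rintro rfl
      exact hne rfl
    · exact Or.inl (vertex_mul_word_of_ne R h' hu)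
  | cons e l ih =>
    cases l' with
    | nil => simp at hlen
    | cons e' l' =>
      rw [word_cons, word_cons, star_mul, star_edge, mul_assoc]
      by_cases he : e = e'
      · subst he
        rw [ghost_mul_edge_mul_self, vertex_mul_word R h'.2]
        refine ih h.2 h'.2 (by simpa using hlen) ?_
        intro heq
        obtain ⟨_, rfl⟩ := Prod.mk.inj heq
        exact hne (by rw [← h.1, ← h'.1])
      · exact Or.inl (by rw [ghost_mul_edge_mul_of_ne G R he, mul_zero])

theorem evalAt_cons (v : V) (t : R × List E) (p : List (R × List E)) :
    evalAt G v (t :: p) = t.1 • word G R v t.2 + evalAt G v p := by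
  rw [evalAt, List.map_cons, List.sum_cons]; rfl

/-- A nonzero linear combination of paths ending at `v` can be multiplied to the left such that
the result has a nonzero constant coefficient. -/
theorem exists_star_word_mul_eq {v : V} {z : LPA G R} (hz : z ∈ realPoly G R v) (hz0 : z ≠ 0) :
    ∃ (a : LPA G R) (r : R) (p : List (R × List E)), r ≠ 0 ∧ AreClosedAt G v p ∧
      a * z = r • vertex G R v + evalAt G v p := by
  classical
  obtain ⟨c, hc, rfl⟩ := (Finsupp.mem_span_image_iff_linearCombination R).mp hz
  have hc0 : c.support.Nonempty := by
    rw [Finsupp.support_nonempty_iff]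
    rintro rfl
    exact hz0 (map_zero _)
  -- With `t` of minimal length, multiplication by `t^*` turns `t` into `v` and every other path
  -- into zero or a closed path of positive length, so the coefficient of `v` is exactly `c t`.
  obtain ⟨t, ht, hmin⟩ := Finset.exists_min_image c.support (fun t => t.2.length) hc0
  have hpath : ∀ s ∈ c.support, G.IsPathFromTo s.1 s.2 v := fun s hs => hc hs
  have hsum : ∀ S : Finset (V × List E), S ⊆ c.support.erase t →
      ∃ p : List (R × List E), AreClosedAt G v p ∧
        ∑ s ∈ S, c s • (star (word G R t.1 t.2) * word G R s.1 s.2) = evalAt G v p := by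
    intro S
    induction S using Finset.induction_on with
    | empty => exact fun _ => ⟨[], by simp [AreClosedAt], by simp [evalAt]⟩
    | insert s S hs ih =>
      intro hS
      obtain ⟨p, hp, hp'⟩ := ih ((Finset.subset_insert s S).trans hS)
      have hsS := Finset.mem_erase.mp (hS (Finset.mem_insert_self s S))
      rw [Finset.sum_insert hs, hp']
      rcases star_word_mul_word_eq_zero_or (R := R) (hpath t ht) (hpath s hsS.2) (hmin s hsS.2)
        (Ne.symm hsS.1) with h | ⟨m, hm, hm', h⟩
      · exact ⟨p, hp, by rw [h, smul_zero, zero_add]⟩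
      · refine ⟨(c s, m) :: p, ?_, by rw [h, evalAt_cons]⟩
        intro q hq
        rcases List.mem_cons.mp hq with rfl | hq
        · exact ⟨hm, hm'⟩
        · exact hp q hq
  obtain ⟨p, hp, hp'⟩ := hsum _ subset_rfl
  refine ⟨star (word G R t.1 t.2), c t, p, Finsupp.mem_support_iff.mp ht, hp, ?_⟩
  rw [Finsupp.linearCombination_apply, Finsupp.sum, Finset.mul_sum, ← hp',
    ← Finset.add_sum_erase _ _ ht, mul_smul_comm, star_word_mul_word R (hpath t ht)]
  simp only [mul_smul_comm]

theorem component_evalAt {v : V} {p : List (R × List E)} (hp : AreClosedAt G v p) :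
    component G R 0 (evalAt G v p) = 0 := by
  induction p with
  | nil => simp [evalAt]
  | cons t p ih =>
    have ht := hp t (by simp)
    have hl := List.length_pos_iff.mpr ht.1
    rw [evalAt_cons, map_add, ih fun s hs => hp s (List.mem_cons_of_mem _ hs), map_smul,
      isHomogeneousOf_word.1.component_of_ne (by omega), smul_zero, zero_add]

theorem component_evalAt_mul_edge {v : V} {p : List (R × List E)} (hp : AreClosedAt G v p)
    (f : E) : component G R 1 (evalAt G v p * edge G R f) = 0 := by
  induction p with
  | nil => simp [evalAt]
  | cons t p ih =>
    have ht := hp t (by simp)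
    have hl := List.length_pos_iff.mpr ht.1
    rw [evalAt_cons, add_mul, map_add, ih fun s hs => hp s (List.mem_cons_of_mem _ hs),
      smul_mul_assoc, map_smul,
      (isHomogeneousOf_word.1.mul (isHomogeneousOf_edge G R f)).component_of_ne (by omega),
      smul_zero, zero_add]

/-- The closed paths have positive degree, so the component of degree zero is `r v`. -/
theorem smul_vertex_add_evalAt_ne_zero {v : V} {r : R} (hr : r ≠ 0) {p : List (R × List E)}
    (hp : AreClosedAt G v p) : r • vertex G R v + evalAt G v p ≠ 0 := by
  intro h
  apply hr
  have h1 := congrArg (component G R 0) h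
  rw [map_add, component_evalAt hp, add_zero, map_zero,
    ((isHomogeneousOf_vertex G R v).smul r).component_self] at h1
  exact eq_zero_of_smul_vertex_eq_zero G R (Subtype.ext h1)

/-- For `z ≠ 0` some `a z` is `r v` plus closed paths with `r ≠ 0`. The degree-one component of `a z
f` is then `r f`, which is nonzero because `f^* (r f) = r • r(f)`. -/
theorem eq_zero_of_mul_edge_eq_zero {f : E} {z : LPA G R}
    (hz : z ∈ realPoly G R (G.source f)) (h : z * edge G R f = 0) : z = 0 := by
  by_contra hz0
  obtain ⟨a, r, p, hr, hp, ha⟩ := exists_star_word_mul_eq hz hz0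
  apply hr
  have h1 : component G R 1 (a * z * edge G R f) = 0 := by
    rw [mul_assoc, h, mul_zero, map_zero]
  rw [ha, add_mul, map_add, component_evalAt_mul_edge hp, add_zero, smul_mul_assoc,
    source_mul_edge, ((isHomogeneousOf_edge G R f).smul r).component_self] at h1
  have h2 : r • edge G R f = 0 := Subtype.ext h1
  refine eq_zero_of_smul_vertex_eq_zero G R (v := G.range f) ?_
  rw [← ghost_mul_edge_self, ← mul_smul_comm, h2, mul_zero]

end ClosedSums

/-! ### Special elements of a nonzero ideal. -/

section Reduction

variable {V E : Type*} {G : DirectedMultigraph V E} {R : Type*}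

/-- The effect on a list of paths of replacing `x` by `e^* x e`. -/
def rotateAt [DecidableEq E] (e : E) (p : List (R × List E)) : List (R × List E) :=
  p.filterMap fun t => match t.2 with
    | [] => none
    | f :: b => if f = e then some (t.1, b ++ [e]) else none

theorem areClosedAt_rotateAt [DecidableEq E] {e : E} {p : List (R × List E)}
    (hp : AreClosedAt G (G.source e) p) : AreClosedAt G (G.range e) (rotateAt e p) := by
  intro t ht
  obtain ⟨⟨r, l⟩, hs, hst⟩ := List.mem_filterMap.mp ht
  have h := hp _ hs
  cases l with
  | nil => simp at hst
  | cons f b =>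
    simp only [Option.ite_none_right_eq_some, Option.some.injEq] at hst
    obtain ⟨rfl, rfl⟩ := hst
    exact ⟨by simp, isPathFromTo_snoc h.2.2⟩

variable [CommRing R]

/-- As long as some edge at `v` does not annihilate `x`, multiplying by it lowers the ghost length.
Otherwise `x = z - ∑ z e e^*` for a real polynomial `z` and any large enough finite set of edges at
`v`, and the number of edges at `v` decides. -/
theorem exists_realPoly_mem {K : Set (LPA G R)} (hr : ∀ x ∈ K, ∀ a, x * a ∈ K) {n : ℕ} {v : V}
    {x : LPA G R} (hx : x ∈ ghostForm G R n v) (hx0 : x ≠ 0) (hK : x ∈ K) :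
    ∃ w, ∃ z ∈ realPoly G R w, z ≠ 0 ∧ z ∈ K := by
  classical
  induction n generalizing v x with
  | zero => exact ⟨v, x, hx, hx0, hK⟩
  | succ n ih =>
    by_cases he : ∃ e, G.source e = v ∧ x * edge G R e ≠ 0
    · obtain ⟨e, rfl, he⟩ := he
      exact ih (mul_edge_mem_ghostForm hx) he (hr x hK _)
    · push Not at he
      obtain ⟨z, hz, F, hF, h⟩ := exists_realPoly_sub_eq hx
      have hF' : ∀ F' : Finset E, F ⊆ F' → (∀ e ∈ F', G.source e = v) →
          x + ∑ e ∈ F', z * edge G R e * ghost G R e = z := by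
        intro F' h1 h2
        rw [h F' h1, Finset.sum_eq_zero, add_zero]
        intro e he'
        rw [he e (h2 e he'), zero_mul]
      by_cases hfin : {e : E | G.source e = v}.Finite
      · by_cases hne : {e : E | G.source e = v}.Nonempty
        -- Summing over all edges at `v` gives `∑ e e^* = v`, so `x = z - z = 0`.
        · exfalso
          apply hx0
          have h1 := hF' hfin.toFinset (fun e he => by simpa using hF e he) (by simp)
          simp only [mul_assoc] at h1
          rw [← Finset.mul_sum, sum_edge_mul_ghost G R v hfin hne,
            mul_vertex_of_mem_realPoly hz] at h1
          exact add_eq_right.mp h1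
        · refine ⟨v, x, ?_, hx0, hK⟩
          have hF0 : F = ∅ := Finset.eq_empty_of_forall_notMem fun e he => hne ⟨e, hF e he⟩
          have h1 := hF' F subset_rfl hF
          rw [hF0, Finset.sum_empty, add_zero] at h1
          exact h1 ▸ hz
      -- An infinite emitter has an edge `f` outside `F`. Since `x f = 0` and `e^* f = 0` for `e ∈
      -- F`, also `z f = 0`; hence `z = 0` and `x = 0`.
      · exfalso
        obtain ⟨f, hf, hfF⟩ := (Set.not_finite.mp hfin).exists_notMem_finset F
        have hf' : G.source f = v := hf
        subst hf'
        have h1 := hF' F subset_rfl hF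
        have hzf : z * edge G R f = 0 := by
          rw [← h1, add_mul, he f rfl, zero_add, Finset.sum_mul]
          refine Finset.sum_eq_zero fun e heF => ?_
          rw [mul_assoc, ghost_mul_edge_of_ne G R (fun h : e = f => hfF (h ▸ heF)), mul_zero]
        apply hx0
        rw [eq_zero_of_mul_edge_eq_zero hz hzf] at h1
        simpa using h1

theorem ghost_mul_evalAt_mul_edge [DecidableEq E] {e : E} {p : List (R × List E)}
    (hp : AreClosedAt G (G.source e) p) :
    ghost G R e * evalAt G (G.source e) p * edge G R e = evalAt G (G.range e) (rotateAt e p) := by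
  induction p with
  | nil => simp [evalAt, rotateAt]
  | cons t p ih =>
    obtain ⟨r, l⟩ := t
    have ht := hp (r, l) (by simp)
    have ih := ih fun s hs => hp s (List.mem_cons_of_mem _ hs)
    rw [evalAt_cons, mul_add, add_mul, ih]
    cases l with
    | nil => exact absurd rfl ht.1
    | cons f b =>
      simp only [word_cons, mul_smul_comm, smul_mul_assoc]
      by_cases hf : f = e
      · subst hf
        rw [ghost_mul_edge_mul_self, vertex_mul_word R ht.2.2, word_mul_edge R ht.2.2]
        simp [rotateAt, evalAt]
      · rw [ghost_mul_edge_mul_of_ne G R (Ne.symm hf), zero_mul, smul_zero, zero_add]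
        simp [rotateAt, hf]

theorem ghost_mul_mul_edge [DecidableEq E] {e : E} {r : R} {p : List (R × List E)}
    (hp : AreClosedAt G (G.source e) p) :
    ghost G R e * (r • vertex G R (G.source e) + evalAt G (G.source e) p) * edge G R e =
      r • vertex G R (G.range e) + evalAt G (G.range e) (rotateAt e p) := by
  rw [mul_add, add_mul, ghost_mul_evalAt_mul_edge hp, mul_smul_comm, ghost_mul_source,
    smul_mul_assoc, ghost_mul_edge_self]

/-- Every nonzero ideal contains an element `r v + ∑ r_i β_i` with `r ≠ 0`, where the `β_i` are
closed paths at `v` without exits. -/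
theorem exists_mem_noExit {K : Set (LPA G R)} (hl : ∀ x ∈ K, ∀ a, a * x ∈ K)
    (hr : ∀ x ∈ K, ∀ a, x * a ∈ K) {x : LPA G R} (hx : x ∈ K) (hx0 : x ≠ 0) :
    ∃ (v : V) (r : R) (p : List (R × List E)), r ≠ 0 ∧ AreClosedAt G v p ∧
      r • vertex G R v + evalAt G v p ∈ K ∧
      ∀ t ∈ p, ∀ f ∈ t.2, ∀ e : E, G.source e = G.source f → e = f := by
  classical
  let P : ℕ → Prop := fun n => ∃ (v : V) (r : R) (p : List (R × List E)), r ≠ 0 ∧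
    AreClosedAt G v p ∧ r • vertex G R v + evalAt G v p ∈ K ∧ p.length = n
  have hP : ∃ n, P n := by
    obtain ⟨v, hv⟩ := exists_mul_vertex_ne_zero hx0
    obtain ⟨n, hn⟩ := exists_mul_vertex_mem_ghostForm x v
    obtain ⟨w, z, hz, hz0, hzK⟩ := exists_realPoly_mem hr hn hv (hr x hx _)
    obtain ⟨a, r, p, hr0, hp, ha⟩ := exists_star_word_mul_eq hz hz0
    exact ⟨_, w, r, p, hr0, hp, ha ▸ hl z hzK a, rfl⟩
  -- The induction is on the part `a` of a closed path preceding `f`. Rotation changes `v` and `p`,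
  -- so both vary, and only the bound on the number of closed paths is kept.
  have hmin : ∀ (v : V) (r : R) (p : List (R × List E)), r ≠ 0 → AreClosedAt G v p →
      r • vertex G R v + evalAt G v p ∈ K → p.length ≤ Nat.find hP → ∀ a f b,
      (∃ s, (s, a ++ f :: b) ∈ p) → ∀ e : E, G.source e = G.source f → e = f := by
    intro v r p hr0 hp hK hlen a
    have hstep : ∀ v p, AreClosedAt G v p → r • vertex G R v + evalAt G v p ∈ K → ∀ g,
        G.source g = v → r • vertex G R (G.range g) + evalAt G (G.range g) (rotateAt g p) ∈ K ∧
          AreClosedAt G (G.range g) (rotateAt g p) := by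
      rintro _ p hp hK g rfl
      rw [← ghost_mul_mul_edge hp]
      exact ⟨hr _ (hl _ hK _) _, areClosedAt_rotateAt hp⟩
    induction a generalizing v p with
    | nil =>
      rintro f b ⟨s, hs⟩ e he
      by_contra hne
      have hv : G.source f = v := (hp _ hs).2.1
      obtain ⟨h1, h2⟩ := hstep v p hp hK e (he.trans hv)
      -- Conjugating by an exit `e` at `v` kills the path that starts with `f`, against minimality.
      have hlt : (rotateAt e p).length < p.length := by
        refine List.length_filterMap_lt_length_iff_exists.mpr ⟨_, hs, ?_⟩
        simp [Ne.symm hne]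
      exact Nat.find_min hP (hlt.trans_le hlen) ⟨_, r, _, hr0, h2, h1, rfl⟩
    | cons g a ih =>
      rintro f b ⟨s, hs⟩
      have hv : G.source g = v := (hp _ hs).2.1
      obtain ⟨h1, h2⟩ := hstep v p hp hK g hv
      -- Conjugating by `g` moves `g` to the end and brings `f` one step closer to the front.
      exact ih (G.range g) (rotateAt g p) h2 h1 ((List.length_filterMap_le _ _).trans hlen) f
        (b ++ [g]) ⟨s, List.mem_filterMap.mpr ⟨_, hs, by simp⟩⟩
  obtain ⟨v, r, p, hr0, hp, hK, hlen⟩ := Nat.find_spec hP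
  refine ⟨v, r, p, hr0, hp, hK, ?_⟩
  rintro ⟨s, l⟩ ht f hf
  obtain ⟨a, b, rfl⟩ := List.append_of_mem hf
  exact hmin v r p hr0 hp hK hlen.le a f b ⟨s, ht⟩

end Reduction

end Leavitt

namespace Leavitt

open DirectedMultigraph

/-! ### Cycles without exits and distinguished paths. -/

section Cycles

variable {V E : Type*} {G : DirectedMultigraph V E}

theorem isPathFromTo_range_unique {u v w : V} {l : List E} (h : G.IsPathFromTo u l v)
    (h' : G.IsPathFromTo u l w) : v = w := by
  induction l generalizing u with
  | nil => exact h.symm.trans h'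
  | cons e l ih => exact ih h.2 h'.2

theorem isPathFromTo_map_range {τ : ℕ → E} (hτ : G.IsInfinitePath τ) (n k : ℕ) :
    G.IsPathFromTo (G.source (τ n)) ((List.range k).map fun i => τ (n + i))
      (G.source (τ (n + k))) := by
  induction k with
  | zero => rfl
  | succ k ih =>
    rw [List.range_succ, List.map_append]
    exact isPathFromTo_append ih ⟨rfl, hτ (n + k)⟩

variable (G) in
/-- There is a closed path without exits at `u`. -/
def HasNoExitCycle (u : V) : Prop :=
  ∃ l : List E, l ≠ [] ∧ G.IsPathFromTo u l u ∧ ∀ f ∈ l, ∀ e : E, G.source e = G.source f → e = f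

theorem HasNoExitCycle.exists_edge {u : V} (h : HasNoExitCycle G u) :
    ∃ e, G.source e = u ∧ (∀ g, G.source g = u → g = e) ∧ HasNoExitCycle G (G.range e) := by
  obtain ⟨l, hne, hl, hex⟩ := h
  cases l with
  | nil => exact absurd rfl hne
  | cons e b =>
    obtain ⟨rfl, hb⟩ := hl
    refine ⟨e, rfl, fun g hg => hex e (by simp) g hg, b ++ [e], by simp, isPathFromTo_snoc hb, ?_⟩
    intro f hf
    exact hex f (by simpa [or_comm] using hf)

/-- A vertex on a cycle without exits is a distinguished path, and all closed paths at the vertex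
are powers of the associated cycle. -/
theorem HasNoExitCycle.exists_isDistinguished {v : V} (hv : HasNoExitCycle G v) :
    ∃ α c : G.FinPath, IsDistinguished α c ∧ α.source = v ∧ α.edges = [] ∧ c.source = v ∧
      c.range = v ∧ ∀ l, G.IsPathFromTo v l v → ∃ q : ℕ, l = (List.replicate q c.edges).flatten := by
  have hE : Nonempty E := ⟨hv.exists_edge.choose⟩
  have hν : ∀ u, ∃ e, HasNoExitCycle G u →
      G.source e = u ∧ (∀ g, G.source g = u → g = e) ∧ HasNoExitCycle G (G.range e) := by
    intro u
    by_cases hu : HasNoExitCycle G u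
    · obtain ⟨e, he⟩ := hu.exists_edge
      exact ⟨e, fun _ => he⟩
    · exact ⟨hE.some, fun h => absurd h hu⟩
  choose ν hν using hν
  -- On vertices lying on cycles without exits the outgoing edge is unique; `F` follows it, and `τ`
  -- is the forced infinite path from `v`.
  let F : V → V := fun u => G.range (ν u)
  let U : ℕ → V := fun n => F^[n] v
  let τ : ℕ → E := fun n => ν (U n)
  have hU : ∀ n, HasNoExitCycle G (U n) := by
    intro n
    induction n with
    | zero => exact hv
    | succ n ih =>
      rw [show U (n + 1) = F (U n) from Function.iterate_succ_apply' F n v]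
      exact (hν _ ih).2.2
  have hs : ∀ n, G.source (τ n) = U n := fun n => (hν _ (hU n)).1
  have hτ : G.IsInfinitePath τ := fun n => by
    rw [hs]
    exact (Function.iterate_succ_apply' F n v).symm
  -- Every finite path starting at a vertex of `τ` is a segment of `τ`.
  have hpre : ∀ (l : List E) (n : ℕ) (w : V), G.IsPathFromTo (U n) l w →
      l = (List.range l.length).map (fun i => τ (n + i)) ∧ w = U (n + l.length) := by
    intro l
    induction l with
    | nil => exact fun n w h => ⟨rfl, Eq.symm h⟩
    | cons e l ih =>
      intro n w h
      have he : e = τ n := (hν _ (hU n)).2.1 e h.1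
      have h2 : G.IsPathFromTo (U (n + 1)) l w := by
        have := h.2
        rwa [he, hτ n, hs] at this
      obtain ⟨h3, h4⟩ := ih _ _ h2
      constructor
      · rw [List.length_cons, List.range_succ_eq_map, List.map_cons, List.map_map, Nat.add_zero, ← he]
        congr 1
        conv_lhs => rw [h3]
        refine List.map_congr_left fun i _ => ?_
        change τ (n + 1 + i) = τ (n + (i + 1))
        congr 1; omega
      · rw [h4, List.length_cons]; congr 1; omega
  have hper : ∀ l, G.IsPathFromTo v l v → F^[l.length] v = v := by
    intro l hl
    have := (hpre l 0 v hl).2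
    rw [zero_add] at this
    exact this.symm
  obtain ⟨k, hk⟩ : ∃ k, k = Function.minimalPeriod F v := ⟨_, rfl⟩
  have hk1 : 1 ≤ k := by
    obtain ⟨l, hne, hl, _⟩ := hv
    rw [hk]
    exact Function.IsPeriodicPt.minimalPeriod_pos (List.length_pos_iff.mpr hne) (hper l hl)
  have hkv : F^[k] v = v := by rw [hk]; exact Function.iterate_minimalPeriod
  have hdvd : ∀ n, U n = v → k ∣ n := fun n hn => by
    rw [hk]; exact Function.IsPeriodicPt.minimalPeriod_dvd hn
  have hUk : ∀ n, U (n + k) = U n := fun n => by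
    change F^[n + k] v = F^[n] v
    rw [Function.iterate_add_apply, hkv]
  have hτk : ∀ n, τ (n + k) = τ n := fun n => congrArg ν (hUk n)
  have hUmul : ∀ q, U (k * q) = v := by
    intro q
    induction q with
    | zero => rfl
    | succ q ih => rw [Nat.mul_succ, hUk, ih]
  have hτmul : ∀ q i, τ (k * q + i) = τ i := by
    intro q i
    induction q with
    | zero => rw [Nat.mul_zero, Nat.zero_add]
    | succ q ih => rw [Nat.mul_succ, Nat.add_right_comm, hτk, ih]
  have hc := isPathFromTo_map_range hτ 0 k
  rw [hs, hs, hUk 0] at hc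
  simp only [zero_add] at hc
  refine ⟨⟨v, [], v, rfl⟩, ⟨v, (List.range k).map τ, v, hc⟩, ⟨τ, hτ, ⟨0, k, ⟨hk1, fun n _ => hτk n⟩,
    ?_, (hs 0).symm, rfl, (hs 0).symm, by simp⟩, ?_⟩, rfl, rfl, rfl, rfl, ?_⟩
  · intro j' k' h
    -- The index `k * j'` is at least `j'` and `τ` is back at `v` there. The period `k'` therefore
    -- returns `v` to itself and is a multiple of `k`, so `(0, k)` has minimal sum.
    have h1 := h.2 (k * j') (Nat.le_mul_of_pos_left j' hk1)
    have h2 := congrArg G.source h1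
    rw [hs, hs, hUmul] at h2
    have h3 := (Nat.dvd_add_right (Dvd.intro j' rfl)).mp (hdvd _ h2)
    have := Nat.le_of_dvd h.1 h3
    omega
  · intro f hf e he
    obtain ⟨i, _, rfl⟩ := List.mem_map.mp hf
    rw [hs] at he
    exact (hν _ (hU i)).2.1 e he
  · intro l hl
    obtain ⟨h1, h2⟩ := hpre l 0 v hl
    rw [zero_add] at h2
    obtain ⟨q, hq⟩ := hdvd _ h2.symm
    refine ⟨q, ?_⟩
    rw [h1, hq]
    simp only [zero_add]
    clear hq h1 h2 hl
    induction q with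
    | zero => simp
    | succ q ih =>
      rw [Nat.mul_succ, List.range_add, List.map_append, ih, List.replicate_succ',
        List.flatten_append, List.flatten_singleton, List.map_map]
      congr 1
      exact List.map_congr_left fun i _ => hτmul q i

/-- A seed prescribes only sources and edges; the ranges follow because they are determined by
these. -/
theorem cycle_and_range_of_isDistinguished {α c : G.FinPath} (h : IsDistinguished α c) :
    c.edges ≠ [] ∧ c.range = c.source ∧ α.range = c.source := by
  obtain ⟨τ, hτ, ⟨j, k, hjk, _, h1, h2, h3, h4⟩, _⟩ := h
  refine ⟨?_, ?_, ?_⟩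
  · rw [h4]
    intro h
    have := congrArg List.length h
    simp only [List.length_map, List.length_range, List.length_nil] at this
    have := hjk.1
    omega
  · have hp := isPathFromTo_map_range hτ j k
    rw [← h4, hjk.2 j le_rfl, ← h3] at hp
    exact isPathFromTo_range_unique c.isPath hp
  · have hp := isPathFromTo_map_range hτ 0 j
    simp only [zero_add] at hp
    rw [← h2, ← h1, ← h3] at hp
    exact isPathFromTo_range_unique α.isPath hp

end Cycles

/-! ### The algebra generated by `ω_α`. -/

section Omega

variable {V E : Type*} {G : DirectedMultigraph V E} {R : Type*} [CommRing R]

/-- A distinguished path `α` with cycle `c` gives an element `a = α c` with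
`a^* a = α^* α = r(α)` and `a a^* = α α^*`. -/
theorem omega_mul_star_of_isDistinguished {α c : G.FinPath} (h : IsDistinguished α c) :
    omega R α c * star (omega R α c) = ofPath R α * star (ofPath R α) ∧
    star (omega R α c) * omega R α c = ofPath R α * star (ofPath R α) ∧
    star (ofPath R α) * ofPath R α = vertex G R α.range := by
  obtain ⟨_, hcr, hα⟩ := cycle_and_range_of_isDistinguished h
  have hex : c.HasNoExit := by obtain ⟨_, _, _, h⟩ := h; exact h
  have hcp : G.IsPathFromTo c.source c.edges c.source := hcr ▸ c.isPath
  have hαp : G.IsPathFromTo α.source α.edges c.source := hα ▸ α.isPath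
  have h1 : star (ofPath R α) * ofPath R α = vertex G R c.source := star_word_mul_word R hαp
  have h2 : ofPath R c * star (ofPath R c) = vertex G R c.source := word_mul_star_word R hcp hex
  have h3 : star (ofPath R c) * ofPath R c = vertex G R c.source := star_word_mul_word R hcp
  have h4 : ofPath R α * vertex G R c.source = ofPath R α := word_mul_vertex R hαp
  have h5 : ofPath R c * vertex G R c.source = ofPath R c := word_mul_vertex R hcp
  have h6 : star (ofPath R c) * vertex G R c.source = star (ofPath R c) := by
    rw [← star_vertex, ← star_mul]
    exact congrArg star (vertex_mul_word R hcp)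
  rw [hα]
  refine ⟨?_, ?_, h1⟩
  · calc _ = ofPath R α * (ofPath R c * (star (ofPath R α) * ofPath R α) * star (ofPath R c)) *
          star (ofPath R α) := by simp only [omega, star_mul, star_star, mul_assoc]
      _ = _ := by rw [h1, h5, h2, h4]
  · calc _ = ofPath R α * (star (ofPath R c) * (star (ofPath R α) * ofPath R α) * ofPath R c) *
          star (ofPath R α) := by simp only [omega, star_mul, star_star, mul_assoc]
      _ = _ := by rw [h1, h6, h3, h4]

/-- With `γ = α c`, the element `ω_α = γ α^*` has the required form. It is normal because `ω_α
ω_α^*` and `ω_α^* ω_α` both equal `α α^*`, the cycle having no exit. -/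
theorem starGenerated_omega_le {α c : G.FinPath} (h : IsDistinguished α c) :
    starGenerated R (omega R α c) ≤ commutativeCore G R := by
  obtain ⟨_, hcr, hα⟩ := cycle_and_range_of_isDistinguished h
  obtain ⟨h1, h2, _⟩ := omega_mul_star_of_isDistinguished (R := R) h
  have hcp : G.IsPathFromTo α.range c.edges c.source := by rw [hα, ← hcr]; exact hcr ▸ c.isPath
  let γ : G.FinPath := ⟨α.source, α.edges ++ c.edges, c.source, isPathFromTo_append α.isPath hcp⟩
  have hγ : ofPath R γ = ofPath R α * ofPath R c := by
    have : c.source = α.range := hα.symm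
    rw [ofPath, ofPath, ofPath, this]
    exact word_append R α.isPath hcp
  have hω : omega R α c = ofPath R γ * star (ofPath R α) := by rw [hγ, omega]
  refine NonUnitalAlgebra.adjoin_mono ?_
  rintro x (rfl | rfl)
  · exact ⟨⟨γ, α, hα.symm, hω⟩, h1.trans h2.symm⟩
  · refine ⟨⟨α, γ, hα, ?_⟩, ?_⟩
    · rw [hω, star_mul, star_star]
    · rw [star_star]; exact h2.trans h1.symm

/-- The `*`-algebra generated by `ω_α` is isomorphic to the algebra of Laurent polynomials. -/
theorem exists_laurent_of_isDistinguished {α c : G.FinPath} (h : IsDistinguished α c) :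
    ∃ ψ : R[T;T⁻¹] →ₙₐ[R] LPA G R, Function.Injective ψ ∧
      NonUnitalAlgHom.range ψ = starGenerated R (omega R α c) ∧
      ∀ f, ψ (LaurentPolynomial.invert f) = star (ψ f) := by
  obtain ⟨hne, hcr, hα⟩ := cycle_and_range_of_isDistinguished h
  obtain ⟨h1, h2, h3⟩ := omega_mul_star_of_isDistinguished (R := R) h
  have hlen := List.length_pos_iff.mpr hne
  have h4 : ofPath R α * (star (ofPath R α) * ofPath R α) = ofPath R α := by
    rw [h3]; exact word_mul_vertex R α.isPath
  obtain ⟨a, ha⟩ : ∃ a, a = ofPath R α := ⟨_, rfl⟩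
  obtain ⟨b, hb⟩ : ∃ b, b = ofPath R c := ⟨_, rfl⟩
  have hω : omega R α c = a * b * star a := by rw [ha, hb, omega]
  rw [← ha] at h1 h2 h3 h4
  have h5 : star a * a * star a = star a := by
    have := congrArg star h4
    simpa only [star_mul, star_star] using this
  have hpa : a * star a * omega R α c = omega R α c := by
    rw [hω]
    calc _ = a * (star a * a) * b * star a := by simp only [mul_assoc]
      _ = _ := by rw [h4]
  have hap : omega R α c * (a * star a) = omega R α c := by
    rw [hω]
    calc _ = a * b * (star a * a * star a) := by simp only [mul_assoc]
      _ = _ := by rw [h5]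
  have hpb : a * star a * star (omega R α c) = star (omega R α c) := by
    have := congrArg star hap
    simpa only [star_mul, star_star] using this
  have hbp : star (omega R α c) * (a * star a) = star (omega R α c) := by
    have := congrArg star hpa
    simpa only [star_mul, star_star] using this
  obtain ⟨z, hz, hz0, hz1, hz2⟩ :=
    exists_zpowers (L := LPA G R) h1 h2 hpa hap hpb hbp
  refine ⟨laurentLift R z hz, ?_, ?_, ?_⟩
  · have hω1 : IsHomogeneousOf (c.edges.length : ℤ) (z 1) := by
      rw [hz1, omega]
      have := ((isHomogeneousOf_word (G := G) (R := R) (u := α.source) (l := α.edges)).1.mul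
        (isHomogeneousOf_word (G := G) (R := R) (u := c.source) (l := c.edges)).1).mul
        (isHomogeneousOf_word (G := G) (R := R) (u := α.source) (l := α.edges)).2
      convert this using 1
      · ring
      · rfl
    have hω2 : IsHomogeneousOf (-(c.edges.length : ℤ)) (z (-1)) := by
      rw [hz2, omega, star_mul, star_mul, star_star]
      have := (isHomogeneousOf_word (G := G) (R := R) (u := α.source) (l := α.edges)).1.mul
        ((isHomogeneousOf_word (G := G) (R := R) (u := c.source) (l := c.edges)).2.mul
        (isHomogeneousOf_word (G := G) (R := R) (u := α.source) (l := α.edges)).2)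
      convert this using 1
      · ring
      · rfl
    -- As `c` has positive length, distinct powers of `ω_α` lie in distinct degrees.
    have hhom : ∀ n : ℤ, IsHomogeneousOf (n * c.edges.length) (z n) := by
      intro n
      induction n using Int.induction_on with
      | zero =>
        rw [← add_neg_cancel (1 : ℤ), hz]
        convert hω1.mul hω2 using 1
        ring
      | succ n ih =>
        rw [hz]
        convert ih.mul hω1 using 1
        ring
      | pred n ih =>
        rw [sub_eq_add_neg, hz]
        convert ih.mul hω2 using 1
        ring
    rw [injective_iff_map_eq_zero]
    intro f hf
    rw [laurentLift_apply] at hf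
    ext n
    change f.coeff n = 0
    by_contra hn
    have h6 := congrArg (component G R (n * c.edges.length)) hf
    rw [map_sum, map_zero, Finset.sum_eq_single n] at h6
    · rw [((hhom n).smul _).component_self] at h6
      have h7 : f.coeff n • z n = 0 := Subtype.ext h6
      apply hn
      refine eq_zero_of_smul_vertex_eq_zero G R (v := α.range) ?_
      -- The power `z n` is cancelled by `z (-n)`, leaving a multiple of `α α^*`; multiplying by
      -- `α^*` and `α` then leaves the same multiple of `r(α)`.
      have h8 : f.coeff n • (a * star a) = 0 := by
        rw [← hz0, ← add_neg_cancel n, hz, ← smul_mul_assoc, h7, zero_mul]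
      have h9 : star a * (f.coeff n • (a * star a)) * a = f.coeff n • vertex G R α.range := by
        rw [mul_smul_comm, smul_mul_assoc, ← mul_assoc, h5, h3]
      rw [← h9, h8, mul_zero, zero_mul]
    · intro m _ hm
      refine ((hhom m).smul _).component_of_ne fun h => hm ?_
      exact mul_right_cancel₀ (by exact_mod_cast hlen.ne') h
    · intro h
      exact absurd (Finsupp.notMem_support_iff.mp h) hn
  · refine (range_laurentLift (L := LPA G R) z hz).trans ?_
    rw [hz1, hz2]
    rfl
  · exact laurentLift_invert (star_smul_LPA G R) z hz (by rw [hz1, hz2])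

/-- A cycle without exits at `v` together with the vertex `v` generates all closed paths at `v`. -/
theorem HasNoExitCycle.exists_mem_starGenerated {v : V} (hv : HasNoExitCycle G v) :
    ∃ α c : G.FinPath, IsDistinguished α c ∧ ∀ l, G.IsPathFromTo v l v →
      word G R v l ∈ starGenerated R (omega R α c) := by
  obtain ⟨α, c, h, hα1, hα2, hc1, hc2, hl⟩ := hv.exists_isDistinguished
  refine ⟨α, c, h, fun l hlv => ?_⟩
  have hcp : G.IsPathFromTo v c.edges v := by
    have := c.isPath
    rwa [hc1, hc2] at this
  have hα : ofPath R α = vertex G R v := by rw [ofPath, hα1, hα2, word_nil]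
  have hω : omega R α c = word G R v c.edges := by
    rw [omega, hα, star_vertex, ofPath, hc1, vertex_mul_word R hcp, word_mul_vertex R hcp]
  have h1 : omega R α c ∈ starGenerated R (omega R α c) :=
    NonUnitalAlgebra.subset_adjoin R (by simp)
  have h2 : star (omega R α c) ∈ starGenerated R (omega R α c) :=
    NonUnitalAlgebra.subset_adjoin R (by simp)
  have hv : vertex G R v ∈ starGenerated R (omega R α c) := by
    have h3 := (omega_mul_star_of_isDistinguished (R := R) h).1
    rw [hα, star_vertex, vertex_mul_self] at h3
    rw [← h3]
    exact mul_mem h1 h2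
  obtain ⟨q, rfl⟩ := hl l hlv
  clear hlv hl
  suffices ∀ q : ℕ, G.IsPathFromTo v (List.replicate q c.edges).flatten v ∧
      word G R v (List.replicate q c.edges).flatten ∈ starGenerated R (omega R α c) from (this q).2
  intro q
  induction q with
  | zero => exact ⟨rfl, hv⟩
  | succ q ih =>
    rw [List.replicate_succ, List.flatten_cons]
    refine ⟨isPathFromTo_append hcp ih.1, ?_⟩
    rw [word_append R hcp ih.1, ← hω]
    exact mul_mem h1 ih.2

end Omega

end Leavitt

namespace Leavitt

open DirectedMultigraph

/-! ### Condition (b) as injectivity on `⟨ω_α⟩`. -/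

section Laurent

variable {R : Type*} [CommRing R]

/-- The isomorphism `g` need not be inverse to the map `χ` induced by `Φ ∘ ψ`. Still `g ∘ χ` is a
surjective endomorphism of the Laurent polynomials, hence injective, and so `χ` is injective. -/
theorem imageStarIsoLaurent_iff {L A : Type*} [NonUnitalRing L] [StarRing L] [Module R L]
    [IsScalarTower R L L] [SMulCommClass R L L] [NonUnitalRing A] (Φ : L →ₙ+* A)
    {S : NonUnitalSubalgebra R L} {ψ : R[T;T⁻¹] →ₙₐ[R] L} (hψ : Function.Injective ψ)
    (hS : NonUnitalAlgHom.range ψ = S)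
    (hstar : ∀ f, ψ (LaurentPolynomial.invert f) = star (ψ f)) :
    ImageStarIsoLaurent R Φ S ↔ Set.InjOn Φ S := by
  subst hS
  let B := (NonUnitalAlgHom.range ψ).toNonUnitalSubring.map Φ
  have hB : ∀ f, Φ (ψ f) ∈ B := fun f => ⟨ψ f, ⟨f, rfl⟩, rfl⟩
  let χ : R[T;T⁻¹] →ₙ+* B :=
    { toFun := fun f => ⟨Φ (ψ f), hB f⟩
      map_mul' := fun f g => Subtype.ext (by simp)
      map_zero' := Subtype.ext (by simp)
      map_add' := fun f g => Subtype.ext (by simp) }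
  have hχ : Function.Surjective χ := by
    rintro ⟨_, _, ⟨f, rfl⟩, rfl⟩
    exact ⟨f, rfl⟩
  constructor
  · rintro ⟨g, hg⟩
    let θ : R[T;T⁻¹] →ₙ+* R[T;T⁻¹] := (g : B →ₙ+* R[T;T⁻¹]).comp χ
    have hθ : Function.Injective θ := by
      refine laurent_injective_of_surjective_of_smul θ (fun r f => ?_) (g.surjective.comp hχ)
      -- `Φ` is only a ring homomorphism; `R`-linearity of `θ` comes from the scalar operation
      -- transported to the image.
      exact (hg (ψ f) ⟨f, rfl⟩ (χ f) rfl).1 r (χ (r • f)) (congrArg Φ (map_smul ψ r f))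
    rintro _ ⟨f, rfl⟩ _ ⟨f', rfl⟩ h
    have : χ f = χ f' := Subtype.ext h
    exact congrArg ψ (hθ (congrArg g this))
  · intro hinj
    have hχ' : Function.Injective χ := fun f f' h =>
      hψ (hinj ⟨f, rfl⟩ ⟨f', rfl⟩ (congrArg Subtype.val h))
    let e : R[T;T⁻¹] ≃+* B := RingEquiv.ofBijective χ ⟨hχ', hχ⟩
    have he : ∀ (f : R[T;T⁻¹]) (a : B), (a : A) = Φ (ψ f) → e.symm a = f := fun f a ha => by
      rw [RingEquiv.symm_apply_eq]
      exact Subtype.ext ha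
    refine ⟨e.symm, ?_⟩
    rintro _ ⟨f, rfl⟩ a ha
    have hf := he f a ha
    constructor
    · intro r b hb
      rw [hf]
      exact he _ b (hb.trans (congrArg Φ (map_smul ψ r f).symm))
    · intro b hb
      rw [hf]
      exact he _ b (hb.trans (congrArg Φ (hstar f).symm))

theorem starIsoLaurent_iff {A : Type*} [NonUnitalRing A] [StarRing A] [Module R A]
    [IsScalarTower R A A] [SMulCommClass R A A] {B : NonUnitalSubalgebra R A}
    {χ : R[T;T⁻¹] →ₙₐ[R] A} (hB : NonUnitalAlgHom.range χ = B)
    (hstar : ∀ f, χ (LaurentPolynomial.invert f) = star (χ f)) :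
    StarIsoLaurent R B ↔ Function.Injective χ := by
  subst hB
  let χ' : R[T;T⁻¹] →ₙₐ[R] NonUnitalAlgHom.range χ :=
    NonUnitalAlgHom.codRestrict χ _ fun f => ⟨f, rfl⟩
  have hχ : Function.Surjective χ' := by
    rintro ⟨_, f, rfl⟩
    exact ⟨f, rfl⟩
  constructor
  · rintro ⟨g, hg, _⟩
    let θ : R[T;T⁻¹] →ₙ+* R[T;T⁻¹] := ((g.comp χ' : R[T;T⁻¹] →ₙₐ[R] R[T;T⁻¹]) : _ →ₙ+* _)
    have hθ : Function.Injective θ :=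
      laurent_injective_of_surjective_of_smul θ (map_smul (g.comp χ')) (hg.2.comp hχ)
    intro f f' h
    have : χ' f = χ' f' := Subtype.ext h
    exact hθ (congrArg g this)
  · intro hinj
    have hχ' : Function.Bijective χ' := ⟨fun f f' h => hinj (congrArg Subtype.val h), hχ⟩
    obtain ⟨k, hk1, hk2⟩ := Function.bijective_iff_has_inverse.mp hχ'
    refine ⟨NonUnitalAlgHom.inverse χ' k hk1 hk2, ⟨hk2.injective, hk1.surjective⟩, ?_⟩
    intro a b h
    obtain ⟨f, rfl⟩ := hχ b
    have ha : a = χ' (LaurentPolynomial.invert f) := by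
      have h' : (a : A) = star (χ f) := by
        rw [← star_star (a : A), ← h]; rfl
      exact Subtype.ext (h'.trans (hstar f).symm)
    change k (χ' f) = LaurentPolynomial.invert (k a)
    rw [ha, hk1, hk1]
    exact (LaurentPolynomial.involutive_invert f).symm

/-- `Φ ∘ ψ` maps the Laurent polynomials onto the `*`-algebra generated by `Φ a`, because `Φ`
preserves the involution; so `starIsoLaurent_iff` applies to it. -/
theorem starIsoLaurent_starGenerated_iff {L A : Type*} [NonUnitalRing L] [StarRing L] [Module R L]
    [IsScalarTower R L L] [SMulCommClass R L L] [NonUnitalRing A] [StarRing A] [Module R A]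
    [IsScalarTower R A A] [SMulCommClass R A A] (Φ : L →ₙₐ[R] A)
    (hΦ : ∀ x, Φ (star x) = star (Φ x)) {a : L} {b : A}
    (hb : Φ a = b) {ψ : R[T;T⁻¹] →ₙₐ[R] L}
    (hψ : Function.Injective ψ) (ha : NonUnitalAlgHom.range ψ = starGenerated R a)
    (hstar : ∀ f, ψ (LaurentPolynomial.invert f) = star (ψ f)) :
    StarIsoLaurent R (starGenerated R b) ↔ Set.InjOn Φ (starGenerated R a) := by
  subst hb
  have h1 : NonUnitalAlgHom.range (Φ.comp ψ) = starGenerated R (Φ a) := by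
    rw [NonUnitalAlgHom.range_comp, ha, starGenerated, NonUnitalAlgHom.map_adjoin, Set.image_pair,
      hΦ]
    rfl
  have h2 : ∀ f, Φ.comp ψ (LaurentPolynomial.invert f) = star (Φ.comp ψ f) := fun f => by
    rw [NonUnitalAlgHom.comp_apply, NonUnitalAlgHom.comp_apply, hstar, hΦ]
  rw [starIsoLaurent_iff h1 h2, ← ha]
  constructor
  · rintro hinj _ ⟨f, rfl⟩ _ ⟨f', rfl⟩ h
    exact congrArg ψ (hinj h)
  · intro hinj f f' h
    exact hψ (hinj ⟨f, rfl⟩ ⟨f', rfl⟩ h)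

end Laurent

/-! ### The uniqueness theorem. -/

section Uniqueness

variable {V E : Type*} {G : DirectedMultigraph V E} {R : Type*} [CommRing R]

theorem injective_of_injOn_starGenerated {A : Type*} [NonUnitalRing A] (Φ : LPA G R →ₙ+* A)
    (hv : ∀ (v : V) (r : R), r ≠ 0 → Φ (r • vertex G R v) ≠ 0)
    (hω : ∀ α c : G.FinPath, IsDistinguished α c →
      Set.InjOn Φ (starGenerated R (omega R α c))) : Function.Injective Φ := by
  rw [injective_iff_map_eq_zero]
  intro x hx
  by_contra hx0
  obtain ⟨v, r, p, hr, hp, hK, hex⟩ := exists_mem_noExit (K := {x | Φ x = 0})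
    (fun x (hx : Φ x = 0) a => by simp [hx]) (fun x (hx : Φ x = 0) a => by simp [hx]) hx hx0
  have hK : Φ (r • vertex G R v + evalAt G v p) = 0 := hK
  by_cases hp0 : p = []
  · subst hp0
    rw [evalAt, List.map_nil, List.sum_nil, add_zero] at hK
    exact hv v r hr hK
  · obtain ⟨t, ht⟩ := List.exists_mem_of_ne_nil p hp0
    obtain ⟨α, c, h, hl⟩ := HasNoExitCycle.exists_mem_starGenerated (R := R)
      (show HasNoExitCycle G v from ⟨t.2, (hp t ht).1, (hp t ht).2, hex t ht⟩)
    -- The special element is nonzero by its degree-zero part, yet it is a combination of closed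
    -- paths at `v` (the empty one giving `v`), hence an element of `⟨ω_α⟩` killed by `Φ`.
    refine smul_vertex_add_evalAt_ne_zero hr hp (hω α c h ?_ (zero_mem _)
      (hK.trans (map_zero Φ).symm))
    refine add_mem (SMulMemClass.smul_mem r (hl [] rfl)) (list_sum_mem fun y hy => ?_)
    obtain ⟨s, hs, rfl⟩ := List.mem_map.mp hy
    exact SMulMemClass.smul_mem _ (hl _ (hp s hs).2)

theorem smul_vertex_mem_commutativeCore (v : V) (r : R) :
    r • vertex G R v ∈ commutativeCore G R := by
  refine SMulMemClass.smul_mem r (NonUnitalAlgebra.subset_adjoin R ⟨⟨⟨v, [], v, rfl⟩,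
    ⟨v, [], v, rfl⟩, rfl, ?_⟩, ?_⟩)
  · rw [ofPath, word_nil, star_vertex, vertex_mul_self]
  · rw [star_vertex]

/-- The predicate `P` stands for either reading of condition (b), so that one argument serves both
settings. -/
theorem tfae_injective {A : Type*} [NonUnitalRing A] (Φ : LPA G R →ₙ+* A)
    {P : G.FinPath → G.FinPath → Prop}
    (hP : ∀ α c, IsDistinguished α c →
      (P α c ↔ Set.InjOn Φ (starGenerated R (omega R α c)))) :
    List.TFAE
      [Function.Injective Φ,
       Set.InjOn Φ (commutativeCore G R : Set (LPA G R)),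
       (∀ (v : V) (r : R), r ≠ 0 → Φ (r • vertex G R v) ≠ 0) ∧
       (∀ α c : G.FinPath, IsDistinguished α c → P α c)] := by
  tfae_have 1 → 2 := fun h => h.injOn
  tfae_have 2 → 3 := by
    intro h
    refine ⟨fun v r hr h0 => hr ?_, fun α c hα => ?_⟩
    · refine eq_zero_of_smul_vertex_eq_zero G R (v := v) ?_
      exact h (smul_vertex_mem_commutativeCore v r) (zero_mem _) (h0.trans (map_zero Φ).symm)
    · exact (hP α c hα).mpr (h.mono (starGenerated_omega_le hα))
  tfae_have 3 → 1 := fun h =>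
    injective_of_injOn_starGenerated Φ h.1 fun α c hα => (hP α c hα).mp (h.2 α c hα)
  tfae_finish

theorem imageStarIsoLaurent_omega_iff {A : Type*} [NonUnitalRing A] (Φ : LPA G R →ₙ+* A)
    {α c : G.FinPath} (h : IsDistinguished α c) :
    ImageStarIsoLaurent R Φ (starGenerated R (omega R α c)) ↔
      Set.InjOn Φ (starGenerated R (omega R α c)) := by
  obtain ⟨ψ, hψ, hS, hstar⟩ := exists_laurent_of_isDistinguished (R := R) h
  exact imageStarIsoLaurent_iff (L := LPA G R) Φ hψ hS hstar

theorem starIsoLaurent_omega_iff {A : Type*} [NonUnitalRing A] [StarRing A] [Module R A]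
    [IsScalarTower R A A] [SMulCommClass R A A] (Φ : LPA G R →ₙₐ[R] A)
    (hΦ : ∀ x : LPA G R, Φ (star x) = star (Φ x)) {α c : G.FinPath} (h : IsDistinguished α c) :
    StarIsoLaurent R (starGenerated R (Φ (omega R α c))) ↔
      Set.InjOn Φ (starGenerated R (omega R α c)) := by
  obtain ⟨ψ, hψ, hS, hstar⟩ := exists_laurent_of_isDistinguished (R := R) h
  have key := starIsoLaurent_starGenerated_iff (L := LPA G R) (a := omega R α c) (ψ := ψ) Φ hΦ rfl
    hψ hS hstar
  exact ⟨fun h1 => key.1 h1, fun h1 => key.2 h1⟩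

end Uniqueness

end Leavitt

theorem mainTheorem3 {V : Type*} {E : Type*}
    (G : DirectedMultigraph V E) (R : Type*) [CommRing R] :
    -- arbitrary ring homomorphisms into an arbitrary ring
    (∀ (A : Type*) [NonUnitalRing A] (Φ : Leavitt.LPA G R →ₙ+* A),
      List.TFAE
        [Function.Injective Φ,
         Set.InjOn Φ (Leavitt.commutativeCore G R : Set (Leavitt.LPA G R)),
         (∀ (v : V) (r : R), r ≠ 0 → Φ (r • Leavitt.vertex G R v) ≠ 0) ∧
         (∀ α c : G.FinPath, DirectedMultigraph.IsDistinguished α c →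
            Leavitt.ImageStarIsoLaurent R Φ
              (Leavitt.starGenerated R (Leavitt.omega R α c)))]) ∧
    -- homomorphisms of `R`-algebras with involution
    (∀ (A : Type*) [NonUnitalRing A] [StarRing A] [Module R A] [IsScalarTower R A A]
        [SMulCommClass R A A] (_hA : ∀ (r : R) (a : A), star (r • a) = r • star a)
        (Φ : Leavitt.LPA G R →ₙₐ[R] A) (_hΦ : ∀ x : Leavitt.LPA G R, Φ (star x) = star (Φ x)),
      List.TFAE
        [Function.Injective Φ,
         Set.InjOn Φ (Leavitt.commutativeCore G R : Set (Leavitt.LPA G R)),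
         (∀ (v : V) (r : R), r ≠ 0 → Φ (r • Leavitt.vertex G R v) ≠ 0) ∧
         (∀ α c : G.FinPath, DirectedMultigraph.IsDistinguished α c →
            Leavitt.StarIsoLaurent R
              (Leavitt.starGenerated R (Φ (Leavitt.omega R α c))))]) := by
  constructor
  · intro A _ Φ
    exact Leavitt.tfae_injective Φ fun α c h => Leavitt.imageStarIsoLaurent_omega_iff Φ h
  · intro A _ _ _ _ _ _ Φ hΦ
    have key := Leavitt.tfae_injective (Φ : Leavitt.LPA G R →ₙ+* A)
      (P := fun α c => Leavitt.StarIsoLaurent R (Leavitt.starGenerated R (Φ (Leavitt.omega R α c))))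
    exact key fun α c h => Leavitt.starIsoLaurent_omega_iff Φ hΦ h
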